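/- Let $B\subset\mathbb Z^2$ be a finite non-empty $\mathbb Z$-convex set, i.e. $B$ is the set of all lattice points of its convex hull $\mathrm{conv}(B)\subset\mathbb R^2$; write $\mathrm{area}(B)$ for the area of $\mathrm{conv}(B)$. For $u\in\mathbb Z^2$ put $\omega_u(B)=\max_{x,y\in B}u\cdot(x-y)$ and $\omega(B)=\min_{u\in\mathbb Z^2\setminus\{0\}}\omega_u(B)$. The integer length of a segment is the number of lattice points on it minus one. For an integer $m\ge 0$, the set $B$ is called $m$-thick if either $\mathrm{conv}(B)$ is one-dimensional of integer length at least $m$, or $\mathrm{conv}(B)$ is two-dimensional and for every non-zero $u\in\mathbb Z^2$ with $\omega_u(B)=m-a$, $a>0$, the polygon $\mathrm{conv}(B)$ has two distinct sides perpendicular to $u$, each of integer length at least $a$. Let $\mathrm{def}_u(B)=\max(m-\omega_u(B),0)$, and let $D$ be the set of lattice directions, i.e. of primitive vectors $u\in\mathbb Z^2$ with $u$ and $-u$ identified (note that $\mathrm{def}_u=\mathrm{def}_{-u}$). (1) If $B$ is $m$-thick, then $\mathrm{def}_u(B)\neq 0$ for only finitely many $u\in D$, and $$\mathrm{area}(B)+\frac12\sum_{u\in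 D}\mathrm{def}_u(B)^2\ \ge\ \frac38 m^2 .$$ (2) In particular (the case in which $m$ equals the minimal lattice width), every finite non-empty $\mathbb Z$-convex set $B\subset\mathbb Z^2$ satisfies $\mathrm{area}(B)\ge\frac38\,\omega(B)^2$. -/

import Mathlib

open MeasureTheory

noncomputable section

namespace LatticePolygon

/-- The inclusion of `ℤ²` in `ℝ²`. -/
def toPlane (p : ℤ × ℤ) : ℝ × ℝ := ((p.1 : ℝ), (p.2 : ℝ))

/-- The scalar product `u · v` on `ℤ²`. -/
def dot (u v : ℤ × ℤ) : ℤ := u.1 * v.1 + u.2 * v.2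

/-- The convex hull in `ℝ²` of a set of lattice points. -/
def hull (B : Set (ℤ × ℤ)) : Set (ℝ × ℝ) := convexHull ℝ (toPlane '' B)

/-- The lattice points of a subset of `ℝ²`. -/
def latticePoints (E : Set (ℝ × ℝ)) : Set (ℤ × ℤ) := {p | toPlane p ∈ E}

/-- `ℤ`-convex hull: the lattice points of the convex hull. -/
def zHull (B : Set (ℤ × ℤ)) : Set (ℤ × ℤ) := latticePoints (hull B)

/-- A set of lattice points is `ℤ`-convex if it consists of all the lattice points of its
convex hull. -/
def IsZConvex (B : Set (ℤ × ℤ)) : Prop := B = zHull B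

/-- The area of a lattice polygon: the Lebesgue measure of its convex hull in `ℝ²`. -/
def area (B : Set (ℤ × ℤ)) : ℝ := (volume (hull B)).toReal

/-- The dimension of a subset of `ℝ²`: the dimension of its affine span. -/
def dim (E : Set (ℝ × ℝ)) : ℕ := Module.finrank ℝ (vectorSpan ℝ E)

/-- The lattice width `ω_u(B) = max {u · (x - y) | x, y ∈ B}`; the maximum exists for finite
non-empty `B`. -/
def width (u : ℤ × ℤ) (B : Set (ℤ × ℤ)) : ℤ :=
  sSup {w : ℤ | ∃ x ∈ B, ∃ y ∈ B, w = dot u (x - y)}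

/-- The minimal lattice width `ω(B)`: the minimum of `ω_u(B)` over the non-zero `u ∈ ℤ²`. -/
def minWidth (B : Set (ℤ × ℤ)) : ℤ :=
  sInf {w : ℤ | ∃ u : ℤ × ℤ, u ≠ 0 ∧ w = width u B}

/-- The integer length of a segment: the number of lattice points on it minus one. -/
def integerLength (E : Set (ℝ × ℝ)) : ℤ := ((latticePoints E).ncard : ℤ) - 1

/-- `E` is a side of the plane convex set `P`: a one-dimensional exposed face of `P`. -/
def IsSide (P E : Set (ℝ × ℝ)) : Prop := IsExposed ℝ P E ∧ dim E = 1

/-- All differences of points of `E` are orthogonal to `u`. -/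
def IsPerp (u : ℤ × ℤ) (E : Set (ℝ × ℝ)) : Prop :=
  ∀ x ∈ E, ∀ y ∈ E, (u.1 : ℝ) * (x.1 - y.1) + (u.2 : ℝ) * (x.2 - y.2) = 0

/-- `m`-thick sets of lattice points. In the two-dimensional case: in every direction `u ≠ 0`
in which the width is `m - a` with `a > 0`, there are two sides that are perpendicular to `u`
and have integer length at least `a`. -/
def IsThick (m : ℕ) (B : Set (ℤ × ℤ)) : Prop :=
  B = ∅ ∨
  (dim (hull B) = 1 ∧ (m : ℤ) ≤ integerLength (hull B)) ∨
  (dim (hull B) = 2 ∧ ∀ u : ℤ × ℤ, u ≠ 0 → ∀ a : ℤ, 0 < a → width u (zHull B) = m - a →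
    ∃ E F : Set (ℝ × ℝ), E ≠ F ∧
      IsSide (hull (zHull B)) E ∧ IsPerp u E ∧ a ≤ integerLength E ∧
      IsSide (hull (zHull B)) F ∧ IsPerp u F ∧ a ≤ integerLength F)

/-- The defect `def_u(B) = max (m - ω_u(B)) 0`. -/
def defect (m : ℕ) (u : ℤ × ℤ) (B : Set (ℤ × ℤ)) : ℤ := max ((m : ℤ) - width u B) 0

/-- The lattice directions: the primitive vectors of `ℤ²`, one from each pair `u, -u` (the one
whose first non-zero coordinate is positive). -/
def directions : Set (ℤ × ℤ) :=
  {u | Int.gcd u.1 u.2 = 1 ∧ (0 < u.1 ∨ (u.1 = 0 ∧ 0 < u.2))}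

end LatticePolygon

end

/-! The two-dimensional case is about plane convex bodies. Choose a basis `u`, `v` of ℤ² with w(u) ≤
w(v) ≤ w(u+v) ≤ w(v−u) for the widths w of the hull P (`exists_reduced_basis`). Only the defects a₁,
a₂, a₃ in the directions `u`, `v`, `u + v` are needed; the other terms of the sum are nonnegative.

If both faces of P orthogonal to `u` contain a translate of a·rot u, then passing to P ∩ (P − a·rot
u) removes area at least a·w(u), lowers the width in every direction x by a|u × x|, and keeps the
face segments in directions not parallel to `u` (`volume_slice`, `rwidth_slice`,
`hasFaceSegments_slice`). Thickness supplies such segments, so three cuts lead to a body Q, still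
reduced for `u`, `v`, whose width along `u` is at least t = m − s, where s = a₁ + a₂ + a₃. The
removed area plus half the squares of the defects is at least sm − s²/2 = (m² − t²)/2, and Q has
area at least 3t²/8. The total is m²/2 − t²/8 ≥ 3m²/8, because 0 ≤ t ≤ m.

The constant 3/8 comes from reduced bodies (`three_eighths_rwidth_sq_le`). In the coordinates given
by `u`, `v` the body touches all four sides of an A × B box, A ≤ B. If the touching points span area
less than AB/2, the width of at least B in a diagonal direction forces further points towards two
opposite corners, and the resulting hexagon has area at least 3A²/8 (`hexagon_area_ineq`).

For a segment, the normal direction alone has defect m, and m²/2 suffices. Part (2) is the case m =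
ω(B), where every defect vanishes. -/

namespace LatticePolygon

/-! ### Linear coordinates in the plane and cutting off triangles. -/

/-- The determinant of two plane vectors. -/
def cross (x y : ℝ × ℝ) : ℝ := x.1 * y.2 - x.2 * y.1

/-- The scalar product of two plane vectors. -/
def pair (u x : ℝ × ℝ) : ℝ := u.1 * x.1 + u.2 * x.2

/-- The vector `u` turned by a right angle. -/
def rot (u : ℝ × ℝ) : ℝ × ℝ := (-u.2, u.1)

/-- The linear map `x ↦ (u · x, v · x)`. -/
noncomputable def coords (u v : ℝ × ℝ) : ℝ × ℝ →ₗ[ℝ] ℝ × ℝ :=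
  Matrix.toLin (.finTwoProd ℝ) (.finTwoProd ℝ) !![u.1, u.2; v.1, v.2]

theorem coords_apply (u v x : ℝ × ℝ) : coords u v x = (pair u x, pair v x) := by
  simp [coords, pair, Matrix.toLin_finTwoProd_apply]

theorem det_coords (u v : ℝ × ℝ) : LinearMap.det (coords u v) = cross u v := by
  simp [coords, cross, LinearMap.det_toLin, Matrix.det_fin_two_of]

theorem volume_real_coords_image (u v : ℝ × ℝ) (s : Set (ℝ × ℝ)) :
    volume.real (coords u v '' s) = |cross u v| * volume.real s := by
  rw [Measure.real, Measure.addHaar_image_linearMap, det_coords, ENNReal.toReal_mul,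
    ENNReal.toReal_ofReal (abs_nonneg _), Measure.real]

theorem volume_real_regionBetween_unit :
    volume.real (regionBetween (fun _ : ℝ => (0 : ℝ)) (fun x => 1 - x) (Set.Ioc 0 1)) = 1 / 2 := by
  have h := volume_regionBetween_eq_integral (μ := volume) (s := Set.Ioc (0 : ℝ) 1)
    (f := fun _ => (0 : ℝ)) (g := fun x => 1 - x)
    (by simp) ((Continuous.integrableOn_Ioc (by fun_prop)))
    measurableSet_Ioc (fun x hx => by linarith [hx.2])
  rw [← Measure.volume_eq_prod] at h
  rw [Measure.real, h, ← intervalIntegral.integral_of_le zero_le_one]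
  simp only [Pi.sub_apply, sub_zero]
  rw [intervalIntegral.integral_sub (by simp) (by simp)]
  norm_num

theorem convex_cross_nonpos (a d : ℝ × ℝ) : Convex ℝ {x : ℝ × ℝ | cross d (x - a) ≤ 0} := by
  intro x hx y hy s t hs ht hst
  have : cross d (s • x + t • y - a) = s * cross d (x - a) + t * cross d (y - a) := by
    obtain rfl : s = 1 - t := by linarith
    simp [cross]; ring
  simp only [Set.mem_ofPred_eq] at *
  rw [this]
  nlinarith [mul_nonneg hs (neg_nonneg.2 hx), mul_nonneg ht (neg_nonneg.2 hy)]

theorem measurableSet_cross_nonpos (a d : ℝ × ℝ) :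
    MeasurableSet {x : ℝ × ℝ | cross d (x - a) ≤ 0} := by
  apply measurableSet_le <;> [skip; fun_prop]
  unfold cross
  fun_prop

/-- Cutting off a triangle from a convex set along the line through one of its sides. -/
theorem volume_real_inter_add_triangle_le {Q : Set (ℝ × ℝ)} (hQ : Convex ℝ Q)
    (hm : MeasurableSet Q) (hf : volume Q ≠ ⊤) {a b c : ℝ × ℝ} (ha : a ∈ Q) (hb : b ∈ Q)
    (hc : c ∈ Q) (h : 0 ≤ cross (b - a) (c - a)) :
    volume.real (Q ∩ {x | cross (b - a) (x - a) ≤ 0}) + cross (b - a) (c - a) / 2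
      ≤ volume.real Q := by
  rcases h.eq_or_lt with h | h
  · rw [← h, zero_div, add_zero]
    exact measureReal_mono Set.inter_subset_left hf
  -- The standard triangle without its base: its image then misses the closed half-plane bounded by
  -- the line through `a` and `b`.
  set T := regionBetween (fun _ : ℝ => (0 : ℝ)) (fun x => 1 - x) (Set.Ioc 0 1)
  set L := coords ((b - a).1, (c - a).1) ((b - a).2, (c - a).2) with hL
  set S := (fun y => a + y) '' (L '' T)
  have hS : volume.real S = cross (b - a) (c - a) / 2 := by
    have h1 : volume.real S = volume.real (L '' T) := by
      simp only [S, Measure.real, Set.image_add_left, measure_preimage_add]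
    rw [h1, hL, volume_real_coords_image, volume_real_regionBetween_unit]
    have : cross ((b - a).1, (c - a).1) ((b - a).2, (c - a).2) = cross (b - a) (c - a) := by
      simp only [cross]; ring
    rw [this, abs_of_pos h]; ring
  have hmem : ∀ x ∈ S, ∃ s t : ℝ, 0 ≤ s ∧ 0 < t ∧ s + t ≤ 1 ∧
      x = a + s • (b - a) + t • (c - a) := by
    rintro _ ⟨_, ⟨y, ⟨h1, h2⟩, rfl⟩, rfl⟩
    refine ⟨y.1, y.2, h1.1.le, h2.1, by linarith [h2.2], ?_⟩
    rw [hL, coords_apply]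
    ext <;> simp [pair] <;> ring
  have hSQ : S ⊆ Q := by
    intro x hx
    obtain ⟨s, t, hs, ht, hst, rfl⟩ := hmem x hx
    have : a + s • (b - a) + t • (c - a) = (1 - s - t) • a + s • b + t • c := by module
    rw [this]
    have := hQ.sum_mem (t := Finset.univ) (w := ![1 - s - t, s, t]) (z := ![a, b, c])
      (by intro i _; fin_cases i <;> simp <;> linarith) (by simp [Fin.sum_univ_three]; ring)
      (by intro i _; fin_cases i <;> simpa)
    simpa [Fin.sum_univ_three] using this
  have hmH := measurableSet_cross_nonpos a (b - a)
  have hdisj : Disjoint (Q ∩ {x | cross (b - a) (x - a) ≤ 0}) S := by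
    rw [Set.disjoint_left]
    rintro x ⟨-, hx⟩ hxS
    obtain ⟨s, t, hs, ht, hst, rfl⟩ := hmem x hxS
    have : cross (b - a) (a + s • (b - a) + t • (c - a) - a) = t * cross (b - a) (c - a) := by
      simp [cross]; ring
    rw [Set.mem_ofPred_eq, this] at hx
    nlinarith [mul_pos ht h]
  rw [← hS, ← measureReal_union' hdisj (hm.inter hmH)
    (measure_ne_top_of_subset Set.inter_subset_left hf) (measure_ne_top_of_subset hSQ hf)]
  exact measureReal_mono (Set.union_subset Set.inter_subset_left hSQ) hf

/-! ### The polynomial inequality for hexagons in a box. -/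

/-- Here `p`, `q` are the legs at one corner and `α`, `β` those at the opposite one, with `p` and
`α` the shorter. If p + α ≤ A, then de ≤ pα ≤ A²/4 is enough. Otherwise the two corner triangles
give back at least min(q, β)(p + α − A). -/
theorem hexagon_area_case {A B p α d e c c' : ℝ} {q β : ℝ} (hA : 0 ≤ A) (hAB : A ≤ B)
    (hp : 0 ≤ p) (hα : 0 ≤ α) (hpq : p ≤ q) (hαβ : α ≤ β) (hqA : q ≤ A) (hβB : β ≤ B) (hαA : α ≤ A)
    (hd0 : 0 ≤ d) (he0 : 0 ≤ e) (hd : d = p + β - B) (he : e = q + α - A)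
    (hc : c ≤ p) (hc' : c' ≤ α) (hcc : c + c' ≤ A) :
    3 / 4 * A ^ 2 ≤ A * B - d * e + q * (p - c) + β * (α - c') := by
  have hdp : d ≤ p := by linarith
  have heα : e ≤ α := by linarith
  have hde : d * e ≤ p * α := mul_le_mul hdp heα he0 hp
  have hx : 0 ≤ q * (p - c) := mul_nonneg (hp.trans hpq) (by linarith)
  have hy : 0 ≤ β * (α - c') := mul_nonneg (hα.trans hαβ) (by linarith)
  have hAA : 0 ≤ A * (B - A) := mul_nonneg hA (by linarith)
  rcases le_total (p + α) A with h | h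
  · nlinarith [sq_nonneg (p - α), mul_nonneg hp hα]
  have key : A * B - d * e + min q β * (p + α - A) ≤ A * B - d * e + q * (p - c) + β * (α - c') := by
    have h1 : min q β * (p - c) ≤ q * (p - c) :=
      mul_le_mul_of_nonneg_right (min_le_left _ _) (by linarith)
    have h2 : min q β * (α - c') ≤ β * (α - c') :=
      mul_le_mul_of_nonneg_right (min_le_right _ _) (by linarith)
    have h3 : 0 ≤ min q β * (A - c - c') :=
      mul_nonneg (le_min (by linarith) (by linarith)) (by linarith)
    nlinarith
  refine le_trans ?_ key
  -- Since p ≥ A − α in this case, it is enough that A² − Aα + α² ≥ 3A²/4, with equality at α = A/2.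
  have hbase : 3 / 4 * A ^ 2 ≤ A * (B - A) + p * (A - α) + A * α := by
    have : 0 ≤ (p - (A - α)) * (A - α) := mul_nonneg (by linarith) (by linarith)
    nlinarith [sq_nonneg (A - 2 * α)]
  rcases le_total q β with h' | h'
  · rw [min_eq_left h']
    have h1 : 0 ≤ (B - β) * e := mul_nonneg (by linarith) he0
    have h2 : 0 ≤ (A - q) * (A - α) := mul_nonneg (by linarith) (by linarith)
    subst hd he
    nlinarith
  · rw [min_eq_right h']
    have h1 : 0 ≤ (A - q) * d := mul_nonneg (by linarith) hd0
    have h2 : 0 ≤ (A - β) * (A - p) := mul_nonneg (by linarith) (by linarith)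
    have h3 : 0 ≤ (B - A) * α := mul_nonneg (by linarith) hα
    subst hd he
    nlinarith

/-- The area of a lattice-reduced hexagon inscribed in an `A × B` box. -/
theorem hexagon_area_ineq {A B p p' q q' r₁ r₂ s₁ s₂ : ℝ} (hA : 0 ≤ A) (hAB : A ≤ B)
    (hp' : 0 ≤ p') (hpB : p ≤ B) (hq' : 0 ≤ q') (hqA : q ≤ A)
    (hpp : p' ≤ p) (hqq : q' ≤ q) (hr₁ : 0 ≤ r₁) (hr₂ : 0 ≤ r₂) (hs₁ : 0 ≤ s₁) (hs₂ : 0 ≤ s₂)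
    (hrp : r₁ + r₂ ≤ p) (hrq : r₁ + r₂ ≤ q) (hsp : s₁ + s₂ ≤ B - p') (hsq : s₁ + s₂ ≤ A - q')
    (hrs : (r₁ + r₂) + (s₁ + s₂) ≤ A) :
    3 / 4 * A ^ 2 ≤ A * B - (p - p') * (q - q') + (p * q - p * r₁ - q * r₂) +
      ((A - q') * (B - p') - (B - p') * s₁ - (A - q') * s₂) := by
  obtain ⟨α, hα⟩ : ∃ α, α = A - q' := ⟨_, rfl⟩
  obtain ⟨β, hβ⟩ : ∃ β, β = B - p' := ⟨_, rfl⟩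
  obtain ⟨d, hd⟩ : ∃ d, d = p - p' := ⟨_, rfl⟩
  obtain ⟨e, he⟩ : ∃ e, e = q - q' := ⟨_, rfl⟩
  rw [← hα, ← hβ, ← hd, ← he]
  have hAB2 : 3 / 4 * A ^ 2 ≤ A * B := by nlinarith
  have hd0 : 0 ≤ d := by linarith
  have he0 : 0 ≤ e := by linarith
  -- For a given sum r₁ + r₂ the corner triangle is smallest when its apex lies on the shorter leg,
  -- so only the sum matters.
  have hX1 : p ≤ q → q * (p - (r₁ + r₂)) ≤ p * q - p * r₁ - q * r₂ := fun h => by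
    nlinarith [mul_nonneg (sub_nonneg.2 h) hr₁]
  have hX2 : q ≤ p → p * (q - (r₁ + r₂)) ≤ p * q - p * r₁ - q * r₂ := fun h => by
    nlinarith [mul_nonneg (sub_nonneg.2 h) hr₂]
  have hY1 : α ≤ β → β * (α - (s₁ + s₂)) ≤ α * β - β * s₁ - α * s₂ := fun h => by
    nlinarith [mul_nonneg (sub_nonneg.2 h) hs₂]
  have hY2 : β ≤ α → α * (β - (s₁ + s₂)) ≤ α * β - β * s₁ - α * s₂ := fun h => by
    nlinarith [mul_nonneg (sub_nonneg.2 h) hs₁]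
  rcases le_total p q with h | h <;> rcases le_total α β with h' | h'
  · have := hexagon_area_case (c := r₁ + r₂) (c' := s₁ + s₂) hA hAB (by linarith : 0 ≤ p)
      (by linarith : 0 ≤ α) h h' hqA (by linarith) (by linarith) hd0 he0 (by linarith) (by linarith) hrp
      (by linarith) hrs
    linarith [hX1 h, hY1 h']
  -- Both shorter legs are parallel. Replacing the longer legs by `e` costs nothing essential: p + β
  -- − d = B ≥ (r₁ + r₂) + (s₁ + s₂), so the total is at least AB.
  · have h1 : e * (p - (r₁ + r₂)) ≤ q * (p - (r₁ + r₂)) :=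
      mul_le_mul_of_nonneg_right (by linarith) (by linarith)
    have h2 : e * (β - (s₁ + s₂)) ≤ α * (β - (s₁ + s₂)) :=
      mul_le_mul_of_nonneg_right (by linarith) (by linarith)
    have h3 : 0 ≤ e * (p + β - (r₁ + r₂) - (s₁ + s₂) - d) := mul_nonneg he0 (by linarith)
    nlinarith [hX1 h, hY2 h']
  · have h1 : d * (q - (r₁ + r₂)) ≤ p * (q - (r₁ + r₂)) :=
      mul_le_mul_of_nonneg_right (by linarith) (by linarith)
    have h2 : d * (α - (s₁ + s₂)) ≤ β * (α - (s₁ + s₂)) :=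
      mul_le_mul_of_nonneg_right (by linarith) (by linarith)
    have h3 : 0 ≤ d * (q + α - (r₁ + r₂) - (s₁ + s₂) - e) := mul_nonneg hd0 (by linarith)
    nlinarith [hX2 h, hY1 h']
  · have := hexagon_area_case (c := s₁ + s₂) (c' := r₁ + r₂) hA hAB (by linarith : 0 ≤ β)
      (by linarith : 0 ≤ q) h' h (by linarith) (by linarith) hqA hd0 he0 (by linarith)
      (by linarith) (by linarith) hrq (by linarith)
    linarith [hX2 h, hY2 h']

/-! ### Quadrilaterals and hexagons inside a convex set. -/

/-- The diagonal from the bottom point to the top point splits the quadrilateral into two triangles,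
whose doubled areas add up to AB − (p − p')(q − q'). -/
theorem quadrilateral_area_le {Q : Set (ℝ × ℝ)} (hQ : Convex ℝ Q) (hm : MeasurableSet Q)
    (hf : volume Q ≠ ⊤) {x₀ y₀ A B p p' q q' : ℝ} (hp : 0 ≤ p) (hpB : p ≤ B) (hp' : 0 ≤ p')
    (hpB' : p' ≤ B) (hq : 0 ≤ q) (hqA : q ≤ A) (hq' : 0 ≤ q') (hqA' : q' ≤ A)
    (hL : (x₀, y₀ + p) ∈ Q) (hR : (x₀ + A, y₀ + p') ∈ Q) (hD : (x₀ + q, y₀) ∈ Q)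
    (hU : (x₀ + q', y₀ + B) ∈ Q) :
    (A * B - (p - p') * (q - q')) / 2 ≤ volume.real Q := by
  have e1 : cross ((x₀ + q, y₀) - (x₀ + q', y₀ + B)) ((x₀ + A, y₀ + p') - (x₀ + q', y₀ + B)) =
      (A - q') * p' + (B - p') * (A - q) := by simp [cross]; ring
  have e2 : cross ((x₀ + q, y₀) - (x₀ + q', y₀ + B)) ((x₀, y₀ + p) - (x₀ + q', y₀ + B)) =
      -(q * (B - p) + q' * p) := by simp [cross]; ring
  have e3 : cross ((x₀ + q', y₀ + B) - (x₀ + q, y₀)) ((x₀, y₀ + p) - (x₀ + q, y₀)) =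
      q * (B - p) + q' * p := by simp [cross]; ring
  have g1 : 0 ≤ (A - q') * p' + (B - p') * (A - q) :=
    add_nonneg (mul_nonneg (by linarith) hp') (mul_nonneg (by linarith) (by linarith))
  have g2 : 0 ≤ q * (B - p) + q' * p :=
    add_nonneg (mul_nonneg hq (by linarith)) (mul_nonneg hq' hp)
  have h1 := volume_real_inter_add_triangle_le hQ hm hf hU hD hR (by rw [e1]; exact g1)
  rw [e1] at h1
  set d := (x₀ + q, y₀) - (x₀ + q', y₀ + B)
  set H := {x : ℝ × ℝ | cross d (x - (x₀ + q', y₀ + B)) ≤ 0}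
  have hDH : (x₀ + q, y₀) ∈ Q ∩ H := ⟨hD, by simp [H, d, cross]; linarith⟩
  have hUH : (x₀ + q', y₀ + B) ∈ Q ∩ H := ⟨hU, by simp [H, cross]⟩
  have hLH : (x₀, y₀ + p) ∈ Q ∩ H := ⟨hL, by
    rw [Set.mem_ofPred_eq, e2]; linarith⟩
  have h2 := volume_real_inter_add_triangle_le (hQ.inter (convex_cross_nonpos _ d))
    (hm.inter (measurableSet_cross_nonpos _ d))
    (measure_ne_top_of_subset Set.inter_subset_left hf) hDH hUH hLH (by rw [e3]; exact g2)
  rw [e3] at h2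
  have h3 : 0 ≤ volume.real (Q ∩ H ∩ {x | cross ((x₀ + q', y₀ + B) - (x₀ + q, y₀))
    (x - (x₀ + q, y₀)) ≤ 0}) := measureReal_nonneg
  linarith

/-- Cut off the triangles at two opposite corners. The four touching points lie in both remaining
half-planes, so the quadrilateral bound applies to what is left. -/
theorem hexagon_area_le {Q : Set (ℝ × ℝ)} (hQ : Convex ℝ Q) (hm : MeasurableSet Q)
    (hf : volume Q ≠ ⊤) {x₀ y₀ A B p p' q q' r₁ r₂ s₁ s₂ : ℝ} (hA : 0 ≤ A) (hAB : A ≤ B)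
    (hp' : 0 ≤ p') (hpB : p ≤ B) (hq' : 0 ≤ q') (hqA : q ≤ A)
    (hpp : p' ≤ p) (hqq : q' ≤ q) (hr₁ : 0 ≤ r₁) (hr₂ : 0 ≤ r₂) (hs₁ : 0 ≤ s₁) (hs₂ : 0 ≤ s₂)
    (hrp : r₁ + r₂ ≤ p) (hrq : r₁ + r₂ ≤ q) (hsp : s₁ + s₂ ≤ B - p') (hsq : s₁ + s₂ ≤ A - q')
    (hrs : (r₁ + r₂) + (s₁ + s₂) ≤ A)
    (hL : (x₀, y₀ + p) ∈ Q) (hR : (x₀ + A, y₀ + p') ∈ Q) (hD : (x₀ + q, y₀) ∈ Q)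
    (hU : (x₀ + q', y₀ + B) ∈ Q) (hr : (x₀ + r₁, y₀ + r₂) ∈ Q)
    (hs : (x₀ + A - s₁, y₀ + B - s₂) ∈ Q) :
    3 / 8 * A ^ 2 ≤ volume.real Q := by
  have key := hexagon_area_ineq hA hAB hp' hpB hq' hqA hpp hqq hr₁ hr₂ hs₁ hs₂ hrp hrq hsp hsq hrs
  have hp : 0 ≤ p := by linarith
  have hq : 0 ≤ q := by linarith
  have e1 : ∀ x y, cross ((x₀, y₀ + p) - (x₀ + q, y₀)) ((x₀ + x, y₀ + y) - (x₀ + q, y₀)) =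
      p * q - p * x - q * y := by intro x y; simp [cross]; ring
  have e2 : ∀ x y, cross ((x₀ + A, y₀ + p') - (x₀ + q', y₀ + B))
      ((x₀ + A - x, y₀ + B - y) - (x₀ + q', y₀ + B)) =
      (A - q') * (B - p') - (B - p') * x - (A - q') * y := by intro x y; simp [cross]; ring
  have g1 : 0 ≤ p * q - p * r₁ - q * r₂ := by
    rcases le_total p q with h | h
    · nlinarith [mul_nonneg (sub_nonneg.2 h) hr₁, mul_nonneg hq (sub_nonneg.2 hrp)]
    · nlinarith [mul_nonneg (sub_nonneg.2 h) hr₂, mul_nonneg hp (sub_nonneg.2 hrq)]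
  have g2 : 0 ≤ (A - q') * (B - p') - (B - p') * s₁ - (A - q') * s₂ := by
    have ha : 0 ≤ A - q' := by linarith
    have hb : 0 ≤ B - p' := by linarith
    rcases le_total (A - q') (B - p') with h | h
    · nlinarith [mul_nonneg (sub_nonneg.2 h) hs₂, mul_nonneg hb (sub_nonneg.2 hsq)]
    · nlinarith [mul_nonneg (sub_nonneg.2 h) hs₁, mul_nonneg ha (sub_nonneg.2 hsp)]
  have h1 := volume_real_inter_add_triangle_le hQ hm hf hD hL hr (by rw [e1]; exact g1)
  rw [e1] at h1
  set d := (x₀, y₀ + p) - (x₀ + q, y₀) with hd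
  set H := {x : ℝ × ℝ | cross d (x - (x₀ + q, y₀)) ≤ 0}
  have memH : ∀ x y, p * q - p * x - q * y ≤ 0 → (x₀ + x, y₀ + y) ∈ H := fun x y h => by
    rw [Set.mem_ofPred_eq, e1]; exact h
  have hRH : (x₀ + A, y₀ + p') ∈ Q ∩ H := ⟨hR, memH _ _ (by
    nlinarith [mul_nonneg hp (sub_nonneg.2 hqA), mul_nonneg hq hp'])⟩
  have hUH : (x₀ + q', y₀ + B) ∈ Q ∩ H := ⟨hU, memH _ _ (by
    nlinarith [mul_nonneg hq (sub_nonneg.2 hpB), mul_nonneg hp hq'])⟩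
  have hDH : (x₀ + q, y₀) ∈ Q ∩ H := ⟨hD, by simpa using memH q 0 (by linarith)⟩
  have hLH : (x₀, y₀ + p) ∈ Q ∩ H := ⟨hL, by simpa using memH 0 p (by linarith)⟩
  -- The second apex must survive the first cut, so that the second triangle can be cut from the
  -- remainder.
  have hsH : (x₀ + A - s₁, y₀ + B - s₂) ∈ Q ∩ H := ⟨hs, by
    have := memH (A - s₁) (B - s₂) (by
      rcases le_total p q with h | h
      · nlinarith [mul_nonneg (sub_nonneg.2 h) (by linarith : 0 ≤ B - s₂),
          mul_nonneg hp (by linarith : 0 ≤ A + B - s₁ - s₂ - q)]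
      · nlinarith [mul_nonneg (sub_nonneg.2 h) (by linarith : 0 ≤ A - s₁),
          mul_nonneg hq (by linarith : 0 ≤ A + B - s₁ - s₂ - p)])
    rwa [← add_sub_assoc, ← add_sub_assoc] at this⟩
  have h2 := volume_real_inter_add_triangle_le (hQ.inter (convex_cross_nonpos _ d))
    (hm.inter (measurableSet_cross_nonpos _ d))
    (measure_ne_top_of_subset Set.inter_subset_left hf) hUH hRH hsH (by rw [e2]; exact g2)
  rw [e2] at h2
  set d' := (x₀ + A, y₀ + p') - (x₀ + q', y₀ + B) with hd'
  set H' := {x : ℝ × ℝ | cross d' (x - (x₀ + q', y₀ + B)) ≤ 0}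
  have memH' : ∀ x y, (A - q') * (y - B) + (B - p') * (x - q') ≤ 0 →
      (x₀ + x, y₀ + y) ∈ H' := fun x y h => by
    have : cross d' ((x₀ + x, y₀ + y) - (x₀ + q', y₀ + B)) =
      (A - q') * (y - B) + (B - p') * (x - q') := by simp [d', cross]; ring
    rw [Set.mem_ofPred_eq, this]; exact h
  have h3 := quadrilateral_area_le (Q := Q ∩ H ∩ H')
    ((hQ.inter (convex_cross_nonpos _ d)).inter (convex_cross_nonpos _ d'))
    ((hm.inter (measurableSet_cross_nonpos _ d)).inter (measurableSet_cross_nonpos _ d'))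
    (measure_ne_top_of_subset (Set.inter_subset_left.trans Set.inter_subset_left) hf)
    hp hpB hp' (by linarith) hq hqA hq' (by linarith)
    ⟨hLH, ?_⟩ ⟨hRH, memH' _ _ (by linarith)⟩ ⟨hDH, ?_⟩ ⟨hUH, memH' _ _ (by linarith)⟩
  · linarith
  · have := memH' 0 p (by
      nlinarith [mul_nonneg (by linarith : 0 ≤ A - q') (by linarith : 0 ≤ B - p),
        mul_nonneg (by linarith : 0 ≤ B - p') hq'])
    rwa [add_zero] at this
  · have := memH' q 0 (by
      nlinarith [mul_nonneg (by linarith : 0 ≤ A - q') hp',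
        mul_nonneg (by linarith : 0 ≤ B - p') (by linarith : 0 ≤ A - q)])
    rwa [add_zero] at this

/-! ### Support functions, widths and the bound for reduced bodies. -/

/-- The support function of a plane set. -/
noncomputable def supp (P : Set (ℝ × ℝ)) (u : ℝ × ℝ) : ℝ := sSup (pair u '' P)

/-- The width of a plane set in the direction `u`. -/
noncomputable def rwidth (P : Set (ℝ × ℝ)) (u : ℝ × ℝ) : ℝ := supp P u + supp P (-u)

theorem continuous_pair (u : ℝ × ℝ) : Continuous (pair u) := by
  unfold pair; fun_prop

theorem supp_eq {P : Set (ℝ × ℝ)} {u x : ℝ × ℝ} (hx : x ∈ P) (h : ∀ y ∈ P, pair u y ≤ pair u x) :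
    supp P u = pair u x :=
  IsGreatest.csSup_eq ⟨⟨x, hx, rfl⟩, by rintro _ ⟨y, hy, rfl⟩; exact h y hy⟩

theorem exists_pair_eq_supp {P : Set (ℝ × ℝ)} (hP : IsCompact P) (hne : P.Nonempty) (u : ℝ × ℝ) :
    ∃ x ∈ P, pair u x = supp P u := by
  obtain ⟨x, hx, h⟩ := hP.exists_isMaxOn hne (continuous_pair u).continuousOn
  exact ⟨x, hx, (supp_eq hx fun y hy => h hy).symm⟩

theorem pair_le_supp {P : Set (ℝ × ℝ)} (hP : IsCompact P) (u : ℝ × ℝ) {x : ℝ × ℝ} (hx : x ∈ P) :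
    pair u x ≤ supp P u :=
  le_csSup (hP.image (continuous_pair u)).bddAbove ⟨x, hx, rfl⟩

theorem pair_neg (u x : ℝ × ℝ) : pair (-u) x = -pair u x := by
  simp [pair]; ring

theorem pair_add (u x y : ℝ × ℝ) : pair u (x + y) = pair u x + pair u y := by
  simp [pair]; ring

theorem pair_sub (u x y : ℝ × ℝ) : pair u (x - y) = pair u x - pair u y := by
  simp [pair]; ring

theorem pair_smul (u x : ℝ × ℝ) (a : ℝ) : pair u (a • x) = a * pair u x := by
  simp [pair]; ring

theorem rwidth_neg (P : Set (ℝ × ℝ)) (u : ℝ × ℝ) : rwidth P (-u) = rwidth P u := by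
  simp [rwidth, add_comm]

theorem rwidth_nonneg {P : Set (ℝ × ℝ)} (hP : IsCompact P) (hne : P.Nonempty) (u : ℝ × ℝ) :
    0 ≤ rwidth P u := by
  obtain ⟨x, hx⟩ := hne
  have := pair_le_supp hP u hx
  have := pair_le_supp hP (-u) hx
  rw [pair_neg] at this
  unfold rwidth; linarith

theorem supp_coords_image (P : Set (ℝ × ℝ)) (u v w : ℝ × ℝ) :
    supp (coords u v '' P) w = supp P (w.1 • u + w.2 • v) := by
  unfold supp
  rw [Set.image_image]
  congr 1
  apply Set.image_congr
  intro x _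
  rw [coords_apply]
  simp [pair]; ring

theorem rwidth_coords_image (P : Set (ℝ × ℝ)) (u v w : ℝ × ℝ) :
    rwidth (coords u v '' P) w = rwidth P (w.1 • u + w.2 • v) := by
  unfold rwidth
  rw [supp_coords_image, supp_coords_image]
  congr 2
  simp; abel

/-- The extreme points in the directions ±(1, 1) serve as the two extra vertices; the hypothesis
`h₂` says exactly that their corner distances satisfy (r₁ + r₂) + (s₁ + s₂) ≤ A. -/
theorem three_eighths_rwidth_sq_le_of_touching {P : Set (ℝ × ℝ)} (hP : IsCompact P)
    (hc : Convex ℝ P) (hne : P.Nonempty) (h₁ : rwidth P (1, 0) ≤ rwidth P (0, 1))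
    (h₂ : rwidth P (0, 1) ≤ rwidth P (1, 1)) {l r d u : ℝ × ℝ} (hl : l ∈ P) (hr : r ∈ P)
    (hd : d ∈ P) (hu : u ∈ P) (el : pair (-(1, 0)) l = supp P (-(1, 0)))
    (er : pair (1, 0) r = supp P (1, 0)) (ed : pair (-(0, 1)) d = supp P (-(0, 1)))
    (eu : pair (0, 1) u = supp P (0, 1)) (hlr : r.2 ≤ l.2) (hud : u.1 ≤ d.1) :
    3 / 8 * rwidth P (1, 0) ^ 2 ≤ volume.real P := by
  obtain ⟨a, ha, ea⟩ := exists_pair_eq_supp hP hne (-(1, 1))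
  obtain ⟨b, hb, eb⟩ := exists_pair_eq_supp hP hne (1, 1)
  have hA := rwidth_nonneg hP hne (1, 0)
  have b1 : ∀ x ∈ P, x.1 ≤ r.1 ∧ l.1 ≤ x.1 ∧ x.2 ≤ u.2 ∧ d.2 ≤ x.2 ∧
      x.1 + x.2 ≤ b.1 + b.2 ∧ a.1 + a.2 ≤ x.1 + x.2 := by
    intro x hx
    have t1 := (pair_le_supp hP (1, 0) hx).trans er.ge
    have t2 := (pair_le_supp hP (-(1, 0)) hx).trans el.ge
    have t3 := (pair_le_supp hP (0, 1) hx).trans eu.ge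
    have t4 := (pair_le_supp hP (-(0, 1)) hx).trans ed.ge
    have t5 := (pair_le_supp hP (1, 1) hx).trans eb.ge
    have t6 := (pair_le_supp hP (-(1, 1)) hx).trans ea.ge
    simp [pair] at t1 t2 t3 t4 t5 t6
    refine ⟨t1, t2, t3, t4, t5, by linarith⟩
  have w1 : rwidth P (1, 0) = r.1 - l.1 := by
    rw [rwidth, ← er, ← el]; simp [pair]; ring
  have w2 : rwidth P (0, 1) = u.2 - d.2 := by
    rw [rwidth, ← eu, ← ed]; simp [pair]; ring
  have w3 : rwidth P (1, 1) = b.1 + b.2 - (a.1 + a.2) := by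
    rw [rwidth, ← eb, ← ea]; simp [pair]; ring
  rw [w1, w2] at h₁
  rw [w2, w3] at h₂
  rw [w1] at hA ⊢
  obtain ⟨l1, l2, l3, l4, l5, l6⟩ := b1 l hl
  obtain ⟨r1, r2, r3, r4, r5, r6⟩ := b1 r hr
  obtain ⟨d1, d2, d3, d4, d5, d6⟩ := b1 d hd
  obtain ⟨u1, u2, u3, u4, u5, u6⟩ := b1 u hu
  obtain ⟨a1, a2, a3, a4, a5, a6⟩ := b1 a ha
  obtain ⟨b1, b2, b3, b4, b5, b6⟩ := b1 b hb
  refine hexagon_area_le (x₀ := l.1) (y₀ := d.2) (A := r.1 - l.1) (B := u.2 - d.2)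
    (p := l.2 - d.2) (p' := r.2 - d.2) (q := d.1 - l.1) (q' := u.1 - l.1)
    (r₁ := a.1 - l.1) (r₂ := a.2 - d.2) (s₁ := r.1 - b.1) (s₂ := u.2 - b.2)
    hc hP.measurableSet hP.measure_ne_top hA h₁ ?_ ?_ ?_ ?_ ?_ ?_ ?_ ?_ ?_ ?_ ?_ ?_ ?_ ?_ ?_
    ?_ ?_ ?_ ?_ ?_ ?_ <;> (try simp only [add_sub_cancel]) <;> (try linarith) <;> (try assumption)
  have : ((r.1 - (r.1 - b.1), u.2 - (u.2 - b.2)) : ℝ × ℝ) = b := by ext <;> simp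
  rwa [this]

theorem three_eighths_rwidth_sq_le_aux {P : Set (ℝ × ℝ)} (hP : IsCompact P)
    (hc : Convex ℝ P) (hne : P.Nonempty) (h₁ : rwidth P (1, 0) ≤ rwidth P (0, 1))
    (h₂ : rwidth P (0, 1) ≤ rwidth P (1, 1)) (h₃ : rwidth P (0, 1) ≤ rwidth P (-1, 1)) :
    3 / 8 * rwidth P (1, 0) ^ 2 ≤ volume.real P := by
  obtain ⟨l, hl, el⟩ := exists_pair_eq_supp hP hne (-(1, 0))
  obtain ⟨r, hr, er⟩ := exists_pair_eq_supp hP hne (1, 0)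
  obtain ⟨d, hd, ed⟩ := exists_pair_eq_supp hP hne (-(0, 1))
  obtain ⟨u, hu, eu⟩ := exists_pair_eq_supp hP hne (0, 1)
  -- Here the correction (p − p')(q − q') is not positive, so the touching points alone span area at
  -- least AB/2 ≥ A²/2.
  have quad : 0 ≤ (l.2 - r.2) * (u.1 - d.1) → 3 / 8 * rwidth P (1, 0) ^ 2 ≤ volume.real P := by
    intro hs
    have hA := rwidth_nonneg hP hne (1, 0)
    have b1 : ∀ x ∈ P, x.1 ≤ r.1 ∧ l.1 ≤ x.1 ∧ x.2 ≤ u.2 ∧ d.2 ≤ x.2 := by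
      intro x hx
      have t1 := (pair_le_supp hP (1, 0) hx).trans er.ge
      have t2 := (pair_le_supp hP (-(1, 0)) hx).trans el.ge
      have t3 := (pair_le_supp hP (0, 1) hx).trans eu.ge
      have t4 := (pair_le_supp hP (-(0, 1)) hx).trans ed.ge
      simp [pair] at t1 t2 t3 t4
      exact ⟨t1, t2, t3, t4⟩
    have w1 : rwidth P (1, 0) = r.1 - l.1 := by
      rw [rwidth, ← er, ← el]; simp [pair]; ring
    have w2 : rwidth P (0, 1) = u.2 - d.2 := by
      rw [rwidth, ← eu, ← ed]; simp [pair]; ring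
    rw [w1, w2] at h₁
    rw [w1] at hA ⊢
    obtain ⟨l1, l2, l3, l4⟩ := b1 l hl
    obtain ⟨r1, r2, r3, r4⟩ := b1 r hr
    obtain ⟨d1, d2, d3, d4⟩ := b1 d hd
    obtain ⟨u1, u2, u3, u4⟩ := b1 u hu
    have := quadrilateral_area_le (x₀ := l.1) (y₀ := d.2) (A := r.1 - l.1) (B := u.2 - d.2)
      (p := l.2 - d.2) (p' := r.2 - d.2) (q := d.1 - l.1) (q' := u.1 - l.1)
      hc hP.measurableSet hP.measure_ne_top (by linarith) (by linarith) (by linarith) (by linarith)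
      (by linarith) (by linarith) (by linarith) (by linarith) (by simpa only [add_sub_cancel])
      (by simpa only [add_sub_cancel]) (by simpa only [add_sub_cancel])
      (by simpa only [add_sub_cancel])
    nlinarith [mul_nonneg hA (sub_nonneg.2 h₁)]
  rcases le_total r.2 l.2 with h | h <;> rcases le_total u.1 d.1 with h' | h'
  · exact three_eighths_rwidth_sq_le_of_touching hP hc hne h₁ h₂ hl hr hd hu el er ed eu h h'
  · exact quad (mul_nonneg (by linarith) (by linarith))
  · exact quad (mul_nonneg_of_nonpos_of_nonpos (by linarith) (by linarith))
  -- The reflection in the vertical axis exchanges `l` with `r` and (1, 1) with (−1, 1), so `h₃`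
  -- takes the role of `h₂`.
  · set φ := coords (-1, 0) (0, 1) with hφ
    have hcont : Continuous φ := LinearMap.continuous_of_finiteDimensional φ
    have hw : ∀ w, rwidth (φ '' P) w = rwidth P (-w.1, w.2) := fun w => by
      rw [hφ, rwidth_coords_image]; simp
    have hs : ∀ w, supp (φ '' P) w = supp P (-w.1, w.2) := fun w => by
      rw [hφ, supp_coords_image]; simp
    have hp : ∀ w x, pair w (φ x) = pair (-w.1, w.2) x := fun w x => by
      rw [hφ, coords_apply]; simp [pair]
    have e0 : rwidth P (-1, 0) = rwidth P (1, 0) := by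
      rw [← rwidth_neg]; simp
    have key := three_eighths_rwidth_sq_le_of_touching (P := φ '' P) (hP.image hcont)
      (hc.linear_image φ) (hne.image φ)
      (by simpa only [hw, neg_zero, e0] using h₁) (by simpa only [hw, neg_zero] using h₃)
      ⟨r, hr, rfl⟩ ⟨l, hl, rfl⟩ ⟨d, hd, rfl⟩ ⟨u, hu, rfl⟩
      (by rw [hp, hs]; simpa using er) (by rw [hp, hs]; simpa using el)
      (by rw [hp, hs]; simpa using ed) (by rw [hp, hs]; simpa using eu)
      (by simpa [hφ, coords_apply, pair] using h) (by simpa [hφ, coords_apply, pair] using h')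
    rw [hw, hφ, volume_real_coords_image] at key
    simpa [cross, e0] using key

/-- The area of a compact convex set that is reduced with respect to a unimodular basis of
directions is at least `3 / 8` times the square of the smallest width. -/
theorem three_eighths_rwidth_sq_le {P : Set (ℝ × ℝ)} (hP : IsCompact P)
    (hc : Convex ℝ P) (hne : P.Nonempty) {u v : ℝ × ℝ} (huv : |cross u v| = 1)
    (h₁ : rwidth P u ≤ rwidth P v) (h₂ : rwidth P v ≤ rwidth P (u + v))
    (h₃ : rwidth P v ≤ rwidth P (v - u)) :
    3 / 8 * rwidth P u ^ 2 ≤ volume.real P := by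
  have hcont : Continuous (coords u v) := LinearMap.continuous_of_finiteDimensional _
  have key := three_eighths_rwidth_sq_le_aux (hP.image hcont)
    (hc.linear_image (coords u v)) (hne.image _)
    (by simpa [rwidth_coords_image] using h₁) (by simpa [rwidth_coords_image] using h₂)
    (by simpa [rwidth_coords_image, sub_eq_neg_add] using h₃)
  rw [volume_real_coords_image, huv, rwidth_coords_image] at key
  simpa using key

/-! ### Slices P ∩ (P − d): chords, widths, faces and area. -/

theorem pair_rot (u w : ℝ × ℝ) : pair u (rot w) = -cross u w := by
  simp [pair, rot, cross]; ring

theorem rot_neg (u : ℝ × ℝ) : rot (-u) = -rot u := by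
  simp [rot]

theorem pair_convex_combo (u x y : ℝ × ℝ) (s t : ℝ) :
    pair u (s • x + t • y) = s * pair u x + t * pair u y := by
  rw [pair_add, pair_smul, pair_smul]

theorem eq_smul_rot {u x : ℝ × ℝ} (hu : u ≠ 0) (h : pair u x = 0) : ∃ s : ℝ, x = s • rot u := by
  have hn : 0 < u.1 ^ 2 + u.2 ^ 2 := by
    rcases eq_or_ne u.1 0 with h1 | h1
    · have h2 : u.2 ≠ 0 := fun h2 => hu (Prod.ext h1 h2)
      positivity
    · positivity
  refine ⟨(u.1 * x.2 - u.2 * x.1) / (u.1 ^ 2 + u.2 ^ 2), ?_⟩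
  simp only [pair] at h
  ext
  · simp only [rot, Prod.smul_fst, smul_eq_mul]
    field_simp
    linear_combination u.1 * h
  · simp only [rot, Prod.smul_snd, smul_eq_mul]
    field_simp
    linear_combination u.2 * h

/-- The face of `P` in the direction `u` contains a translate of `a • rot u`. -/
def HasFaceSegment (P : Set (ℝ × ℝ)) (u : ℝ × ℝ) (a : ℝ) : Prop :=
  ∃ p ∈ P, p + a • rot u ∈ P ∧ ∀ x ∈ P, pair u x ≤ pair u p

/-- Both faces of `P` orthogonal to `u` contain a translate of `a • rot u`. -/
def HasFaceSegments (P : Set (ℝ × ℝ)) (u : ℝ × ℝ) (a : ℝ) : Prop :=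
  HasFaceSegment P u a ∧ HasFaceSegment P (-u) a

/-- The points of `P` whose translate by `d` is also in `P`. -/
def slice (P : Set (ℝ × ℝ)) (d : ℝ × ℝ) : Set (ℝ × ℝ) := P ∩ {x | x + d ∈ P}

theorem hasFaceSegments_zero {P : Set (ℝ × ℝ)} (hP : IsCompact P) (hne : P.Nonempty)
    (u : ℝ × ℝ) : HasFaceSegments P u 0 := by
  have : ∀ u, HasFaceSegment P u 0 := fun u => by
    obtain ⟨x, hx, h⟩ := exists_pair_eq_supp hP hne u
    exact ⟨x, hx, by simpa, fun y hy => (pair_le_supp hP u hy).trans h.ge⟩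
  exact ⟨this u, this (-u)⟩

/-- Interpolating between the two face segments gives a chord a·rot u at the level of `x`. If `x`
lies outside it, convexity allows sliding the chord until it ends at `x`. -/
theorem exists_chord {P : Set (ℝ × ℝ)} (hc : Convex ℝ P) {u : ℝ × ℝ} (hu : u ≠ 0)
    {a : ℝ} (ha : 0 ≤ a) (hS : HasFaceSegments P u a) {x : ℝ × ℝ} (hx : x ∈ P) :
    ∃ t : ℝ, 0 ≤ t ∧ t ≤ a ∧ x - t • rot u ∈ slice P (a • rot u) := by
  obtain ⟨⟨p, hp, hp', hpm⟩, q, hq, hq', hqm⟩ := hS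
  have h1 := hpm x hx
  have h2 := hqm x hx
  rw [pair_neg, pair_neg, neg_le_neg_iff] at h2
  rw [rot_neg] at hq'
  obtain ⟨l, hl0, hl1, hl⟩ : ∃ l : ℝ, 0 ≤ l ∧ l ≤ 1 ∧
      pair u x = (1 - l) * pair u q + l * pair u p := by
    rcases (h2.trans h1).eq_or_lt with h | h
    · exact ⟨0, le_rfl, zero_le_one, by linarith⟩
    · have h3 : 0 < pair u p - pair u q := by linarith
      refine ⟨(pair u x - pair u q) / (pair u p - pair u q), div_nonneg (by linarith) h3.le,
        (div_le_one h3).2 (by linarith), ?_⟩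
      field_simp
      ring
  set y := (1 - l) • (q + a • -rot u) + l • p with hy
  have hyP : y ∈ P := hc hq' hp (by linarith) hl0 (by ring)
  have hyP' : y + a • rot u ∈ P := by
    have : y + a • rot u = (1 - l) • q + l • (p + a • rot u) := by rw [hy]; module
    rw [this]
    exact hc hq hp' (by linarith) hl0 (by ring)
  have hru : pair u (rot u) = 0 := by rw [pair_rot]; simp [cross]; ring
  obtain ⟨s, hs⟩ := eq_smul_rot (u := u) (x := x - y) hu (by
    rw [pair_sub, hy, pair_convex_combo, pair_add, smul_neg, ← neg_smul, pair_smul, hru, hl]; ring)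
  have hxy : x = y + s • rot u := by rw [← hs]; abel
  rcases lt_or_ge s 0 with h | h
  · refine ⟨0, le_rfl, ha, by simpa using hx, ?_⟩
    have hsa : 0 < a - s := by linarith
    have : x - (0 : ℝ) • rot u + a • rot u =
        (1 - a / (a - s)) • x + (a / (a - s)) • (y + a • rot u) := by
      rw [hxy]
      match_scalars <;> field_simp <;> ring
    rw [Set.mem_ofPred_eq, this]
    exact hc hx hyP' (sub_nonneg.2 ((div_le_one hsa).2 (by linarith))) (by positivity) (by ring)
  rcases le_or_gt s a with h' | h'
  · refine ⟨s, h, h', ?_, ?_⟩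
    · rw [hxy]; simpa using hyP
    · rw [hxy, Set.mem_ofPred_eq]; simpa using hyP'
  · refine ⟨a, ha, le_rfl, ?_, by simpa using hx⟩
    have hs0 : 0 < s := by linarith
    have : x - a • rot u = (1 - a / s) • x + (a / s) • y := by
      rw [hxy]
      match_scalars <;> field_simp <;> ring
    rw [this]
    exact hc hx hyP (sub_nonneg.2 ((div_le_one hs0).2 h'.le)) (by positivity) (by ring)

theorem isCompact_slice {P : Set (ℝ × ℝ)} (hP : IsCompact P) (d : ℝ × ℝ) :
    IsCompact (slice P d) :=
  hP.inter_right (hP.isClosed.preimage (by fun_prop : Continuous fun x : ℝ × ℝ => x + d))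

theorem convex_slice {P : Set (ℝ × ℝ)} (hP : Convex ℝ P) (d : ℝ × ℝ) :
    Convex ℝ (slice P d) := by
  refine hP.inter fun x hx y hy s t hs ht hst => ?_
  have : s • x + t • y + d = s • (x + d) + t • (y + d) := by
    rw [smul_add, smul_add, add_add_add_comm, ← add_smul, hst, one_smul]
  rw [Set.mem_ofPred_eq, this]
  exact hP hx hy hs ht hst

theorem slice_nonempty {P : Set (ℝ × ℝ)} (hc : Convex ℝ P) {u : ℝ × ℝ} (hu : u ≠ 0)
    {a : ℝ} (ha : 0 ≤ a) (hS : HasFaceSegments P u a)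
    (hne : P.Nonempty) : (slice P (a • rot u)).Nonempty := by
  obtain ⟨x, hx⟩ := hne
  obtain ⟨t, -, -, h⟩ := exists_chord hc hu ha hS hx
  exact ⟨_, h⟩

/-- A point of the slice and its translate both obey the support bound of P, which gives ≤. Sliding
a maximiser of `w` to the start of its chord attains the bound. -/
theorem supp_slice {P : Set (ℝ × ℝ)} (hP : IsCompact P) (hc : Convex ℝ P) {u : ℝ × ℝ} (hu : u ≠ 0)
    {a : ℝ} (ha : 0 ≤ a) (hS : HasFaceSegments P u a)
    (hne : P.Nonempty) (w : ℝ × ℝ) :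
    supp (slice P (a • rot u)) w = supp P w - max 0 (a * pair w (rot u)) := by
  obtain ⟨x, hx, h⟩ := exists_pair_eq_supp hP hne w
  obtain ⟨t, ht0, ht, hm⟩ := exists_chord hc hu ha hS hx
  have upper : ∀ y ∈ slice P (a • rot u), pair w y ≤ supp P w - max 0 (a * pair w (rot u)) := by
    intro y hy
    have h1 := pair_le_supp hP w hy.1
    have h2 := pair_le_supp hP w hy.2
    rw [pair_add, pair_smul] at h2
    have := max_le (sub_nonneg.2 h1) (by linarith : a * pair w (rot u) ≤ supp P w - pair w y)
    linarith
  have hlow : supp P w - max 0 (a * pair w (rot u)) ≤ pair w (x - t • rot u) := by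
    rw [pair_sub, pair_smul, h]
    rcases le_total 0 (pair w (rot u)) with h0 | h0
    · have := mul_le_mul_of_nonneg_right ht h0
      linarith [le_max_right 0 (a * pair w (rot u))]
    · have := mul_nonpos_of_nonneg_of_nonpos ht0 h0
      linarith [le_max_left 0 (a * pair w (rot u))]
  have heq := le_antisymm (upper _ hm) hlow
  rw [supp_eq hm fun y hy => (upper y hy).trans hlow, heq]

theorem rwidth_slice {P : Set (ℝ × ℝ)} (hP : IsCompact P) (hc : Convex ℝ P) {u : ℝ × ℝ} (hu : u ≠ 0)
    {a : ℝ} (ha : 0 ≤ a) (hS : HasFaceSegments P u a)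
    (hne : P.Nonempty) (w : ℝ × ℝ) :
    rwidth (slice P (a • rot u)) w = rwidth P w - a * |cross u w| := by
  rw [rwidth, supp_slice hP hc hu ha hS hne, supp_slice hP hc hu ha hS hne, rwidth, pair_neg,
    pair_rot]
  have : cross w u = -cross u w := by simp only [cross]; ring
  rw [this, neg_neg]
  rcases le_total 0 (cross u w) with h | h
  · rw [abs_of_nonneg h, max_eq_right (mul_nonneg ha h), max_eq_left]
    · ring
    · nlinarith [mul_nonneg ha h]
  · rw [abs_of_nonpos h, max_eq_left (mul_nonpos_of_nonneg_of_nonpos ha h), max_eq_right]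
    · ring
    · nlinarith [mul_nonneg ha (neg_nonneg.2 h)]

/-- The face in direction `v` is translated as a whole, by 0 or by −a·rot u according to the sign of
v · rot u: maximality forces the chord of each of its points to start or end there. -/
theorem hasFaceSegment_slice {P : Set (ℝ × ℝ)} (hc : Convex ℝ P) {u : ℝ × ℝ} (hu : u ≠ 0)
    {a : ℝ} (ha : 0 ≤ a) (hS : HasFaceSegments P u a)
    {v : ℝ × ℝ} {b : ℝ} (hv : HasFaceSegment P v b)
    (huv : cross u v ≠ 0) : HasFaceSegment (slice P (a • rot u)) v b := by
  obtain ⟨p, hp, hp', hpm⟩ := hv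
  have hvu : pair v (rot u) ≠ 0 := by
    rw [pair_rot]
    intro h
    apply huv
    simp only [cross] at h ⊢
    linarith
  have hvv : pair v (rot v) = 0 := by rw [pair_rot]; simp [cross]; ring
  have hpm' : ∀ x ∈ P, pair v x ≤ pair v (p + b • rot v) := by
    intro x hx
    rw [pair_add, pair_smul, hvv, mul_zero, add_zero]
    exact hpm x hx
  have key : ∀ q ∈ P, (∀ x ∈ P, pair v x ≤ pair v q) →
      q - (if 0 < pair v (rot u) then a else 0) • rot u ∈ LatticePolygon.slice P (a • rot u) := by
    intro q hq hqm
    obtain ⟨t, ht0, ht, hm⟩ := exists_chord hc hu ha hS hq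
    have h1 := hqm _ hm.1
    have h2 := hqm _ hm.2
    rw [pair_add, pair_sub, pair_smul, pair_smul] at h2
    rw [pair_sub, pair_smul] at h1
    split_ifs with h
    · have : t = a := le_antisymm ht (by
        by_contra! h'
        nlinarith [mul_pos (sub_pos.2 h') h])
      rwa [← this] at hm ⊢
    · have h3 : pair v (rot u) < 0 := lt_of_le_of_ne (not_lt.1 h) hvu
      have : t = 0 := le_antisymm (by
        by_contra! h'
        nlinarith [mul_pos h' (neg_pos.2 h3)]) ht0
      rwa [this] at hm
  refine ⟨_, key p hp hpm, ?_, ?_⟩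
  · have := key _ hp' hpm'
    rwa [add_sub_right_comm] at this
  · intro x hx
    rw [pair_sub, pair_smul]
    split_ifs with h
    · have := hpm _ hx.2
      rw [pair_add, pair_smul] at this
      linarith
    · simpa using hpm _ hx.1

theorem hasFaceSegments_slice {P : Set (ℝ × ℝ)} (hc : Convex ℝ P) {u : ℝ × ℝ} (hu : u ≠ 0)
    {a : ℝ} (ha : 0 ≤ a) (hS : HasFaceSegments P u a)
    {v : ℝ × ℝ} {b : ℝ} (hv : HasFaceSegments P v b)
    (huv : cross u v ≠ 0) : HasFaceSegments (slice P (a • rot u)) v b :=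
  ⟨hasFaceSegment_slice hc hu ha hS hv.1 huv, hasFaceSegment_slice hc hu ha hS hv.2 (by
    intro h; apply huv; simp only [cross, Prod.snd_neg, Prod.fst_neg] at h ⊢; linarith)⟩

/-- By Fubini it is enough that every vertical fibre over the projection of P loses length at least
`a`. -/
theorem volume_slice_vertical {P : Set (ℝ × ℝ)} (hP : IsCompact P) (hc : Convex ℝ P)
    (hne : P.Nonempty) {a : ℝ} (ha : 0 ≤ a)
    (hch : ∀ x ∈ P, ∃ t : ℝ, x - (0, t) ∈ slice P (0, a)) :
    volume.real (slice P (0, a)) + a * rwidth P (1, 0) ≤ volume.real P := by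
  set Q := slice P (0, a)
  have hQ : IsCompact Q := isCompact_slice hP _
  obtain ⟨r, hr, er⟩ := exists_pair_eq_supp hP hne (1, 0)
  obtain ⟨l, hl, el⟩ := exists_pair_eq_supp hP hne (-(1, 0))
  have hw : rwidth P (1, 0) = r.1 - l.1 := by
    rw [rwidth, ← er, ← el]; simp [pair]; ring
  have hfib : ∀ x, volume (Prod.mk x ⁻¹' Q) +
      (Set.Icc l.1 r.1).indicator (fun _ => ENNReal.ofReal a) x ≤ volume (Prod.mk x ⁻¹' P) := by
    intro x
    by_cases hx : x ∈ Set.Icc l.1 r.1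
    · rw [Set.indicator_of_mem hx]
      have hcpt : IsCompact (Prod.mk x ⁻¹' Q) := by
        have : Prod.mk x ⁻¹' Q = Prod.snd '' (Q ∩ {z | z.1 = x}) := by
          ext y
          constructor
          · intro hy
            exact ⟨(x, y), ⟨hy, rfl⟩, rfl⟩
          · rintro ⟨⟨z, w⟩, ⟨hz, rfl⟩, rfl⟩
            exact hz
        rw [this]
        exact (hQ.inter_right (isClosed_eq continuous_fst continuous_const)).image continuous_snd
      have hnem : (Prod.mk x ⁻¹' Q).Nonempty := by
        obtain ⟨s, t, hs, ht, hst, hxe⟩ : ∃ s t : ℝ, 0 ≤ s ∧ 0 ≤ t ∧ s + t = 1 ∧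
            s * l.1 + t * r.1 = x := by
          have : x ∈ segment ℝ l.1 r.1 := by rwa [segment_eq_Icc (hx.1.trans hx.2)]
          exact this
        obtain ⟨t', h⟩ := hch _ (hc hl hr hs ht hst)
        refine ⟨_, (?_ : (x, (s • l + t • r - (0, t')).2) ∈ Q)⟩
        convert h using 1
        ext <;> simp [← hxe]
      -- Above the highest point `z` of the sliced fibre, the interval (z, z + a] belongs to P but
      -- not to the slice.
      obtain ⟨z, hz, hzm⟩ := hcpt.exists_isGreatest hnem
      have hsub : Prod.mk x ⁻¹' Q ∪ Set.Ioc z (z + a) ⊆ Prod.mk x ⁻¹' P := by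
        rintro y (hy | hy)
        · exact hy.1
        · have h1 : ((x, z) : ℝ × ℝ) ∈ P := hz.1
          have h2 : ((x, z) : ℝ × ℝ) + (0, a) ∈ P := hz.2
          have ha' : 0 < a := by linarith [hy.1, hy.2]
          have h3 := hc h1 h2 (sub_nonneg.2 ((div_le_one ha').2 (by linarith [hy.2] : y - z ≤ a)))
            (div_nonneg (sub_nonneg.2 hy.1.le) ha'.le) (by ring)
          change (x, y) ∈ P
          convert h3 using 1
          refine Prod.ext ?_ ?_
          · simp; ring
          · simp; field_simp; ring
      have hdis : Disjoint (Prod.mk x ⁻¹' Q) (Set.Ioc z (z + a)) := by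
        rw [Set.disjoint_left]
        intro y hy hy'
        exact absurd (hzm hy) (not_le.2 hy'.1)
      calc _ = volume (Prod.mk x ⁻¹' Q) + volume (Set.Ioc z (z + a)) := by
            rw [Real.volume_Ioc, add_sub_cancel_left]
        _ = volume (Prod.mk x ⁻¹' Q ∪ Set.Ioc z (z + a)) :=
            (measure_union hdis measurableSet_Ioc).symm
        _ ≤ _ := measure_mono hsub
    · rw [Set.indicator_of_notMem hx, add_zero]
      exact measure_mono fun y hy => hy.1
  have hint : volume Q + ENNReal.ofReal a * ENNReal.ofReal (r.1 - l.1) ≤ volume P := by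
    rw [Measure.volume_eq_prod, Measure.prod_apply hQ.measurableSet,
      Measure.prod_apply hP.measurableSet, ← Real.volume_Icc,
      ← lintegral_indicator_const measurableSet_Icc,
      ← lintegral_add_right _ (measurable_const.indicator measurableSet_Icc)]
    exact lintegral_mono hfib
  have hw0 := rwidth_nonneg hP hne (1, 0)
  rw [hw] at hw0 ⊢
  have := ENNReal.toReal_mono hP.measure_ne_top hint
  rwa [ENNReal.toReal_add hQ.measure_ne_top (by finiteness), ENNReal.toReal_mul,
    ENNReal.toReal_ofReal ha, ENNReal.toReal_ofReal hw0] at this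

theorem volume_slice {P : Set (ℝ × ℝ)} (hP : IsCompact P) (hc : Convex ℝ P)
    (hne : P.Nonempty) {u : ℝ × ℝ} (hu : u ≠ 0) {a : ℝ} (ha : 0 ≤ a)
    (hS : HasFaceSegments P u a) :
    volume.real (slice P (a • rot u)) + a * rwidth P u ≤ volume.real P := by
  have hn : u.1 ^ 2 + u.2 ^ 2 ≠ 0 := fun h => by
    apply hu
    ext
    · exact pow_eq_zero_iff two_ne_zero |>.1 (by nlinarith [sq_nonneg u.1, sq_nonneg u.2])
    · exact pow_eq_zero_iff two_ne_zero |>.1 (by nlinarith [sq_nonneg u.1, sq_nonneg u.2])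
  -- This scaling makes the coordinate change area-preserving and sends `rot u` to (0, 1).
  set v : ℝ × ℝ := (u.1 ^ 2 + u.2 ^ 2)⁻¹ • rot u with hv
  have huv : cross u v = 1 := by
    simp [cross, hv, rot]; field_simp
  set φ := coords u v with hφ
  have hcont : Continuous φ := LinearMap.continuous_of_finiteDimensional φ
  have hrot : φ (rot u) = (0, 1) := by
    rw [hφ, coords_apply, hv]
    ext
    · simp [pair, rot]; ring
    · simp [pair, rot]; field_simp; ring
  have hsub : φ '' slice P (a • rot u) ⊆ slice (φ '' P) (0, a) := by
    rintro _ ⟨x, hx, rfl⟩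
    refine ⟨⟨x, hx.1, rfl⟩, ⟨_, hx.2, ?_⟩⟩
    rw [map_add, map_smul, hrot]; simp
  have key := volume_slice_vertical (hP.image hcont) (hc.linear_image φ) (hne.image φ) ha (by
    rintro _ ⟨x, hx, rfl⟩
    obtain ⟨t, -, -, h⟩ := exists_chord hc hu ha hS hx
    refine ⟨t, hsub ⟨_, h, ?_⟩⟩
    rw [map_sub, map_smul, hrot]; simp)
  have h1 : volume.real (φ '' slice P (a • rot u)) ≤ volume.real (slice (φ '' P) (0, a)) :=
    measureReal_mono hsub (isCompact_slice (hP.image hcont) _).measure_ne_top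
  rw [hφ, volume_real_coords_image, huv, abs_one, one_mul] at h1
  rw [hφ, volume_real_coords_image, huv, abs_one, one_mul, rwidth_coords_image] at key
  have e : ((1 : ℝ), (0 : ℝ)).1 • u + ((1 : ℝ), (0 : ℝ)).2 • v = u := by simp
  rw [e] at key
  linarith

/-! ### The area bound with three defects. -/

/-- For `x`, `y` minimising and maximising `u`, equality of the widths forces v · (y − x) ≤ 0, hence
(v − u) · (x − y) ≥ u · (y − x). -/
theorem rwidth_le_rwidth_sub {P : Set (ℝ × ℝ)} (hP : IsCompact P) (hne : P.Nonempty)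
    {u v : ℝ × ℝ} (h : rwidth P u = rwidth P (u + v)) : rwidth P u ≤ rwidth P (v - u) := by
  obtain ⟨x, hx, ex⟩ := exists_pair_eq_supp hP hne (-u)
  obtain ⟨y, hy, ey⟩ := exists_pair_eq_supp hP hne u
  have h1 := pair_le_supp hP (-(u + v)) hx
  have h2 := pair_le_supp hP (u + v) hy
  have h3 := pair_le_supp hP (v - u) hx
  have h4 := pair_le_supp hP (-(v - u)) hy
  unfold rwidth at h ⊢
  simp only [pair, Prod.fst_neg, Prod.snd_neg, Prod.fst_add, Prod.snd_add, Prod.fst_sub,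
    Prod.snd_sub] at *
  linarith

/-- The area bound for a compact convex set that is reduced with respect to a unimodular basis,
with corrections by the defects in the three shortest directions. -/
theorem area_add_defects_ge {P : Set (ℝ × ℝ)} (hP : IsCompact P) (hc : Convex ℝ P)
    (hne : P.Nonempty) {u v : ℝ × ℝ} (huv : |cross u v| = 1) {m a₁ a₂ a₃ : ℝ} (hm : 0 ≤ m)
    (ha₁ : a₁ = max (m - rwidth P u) 0) (ha₂ : a₂ = max (m - rwidth P v) 0)
    (ha₃ : a₃ = max (m - rwidth P (u + v)) 0) (hS₁ : HasFaceSegments P u a₁)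
    (hS₂ : HasFaceSegments P v a₂) (hS₃ : HasFaceSegments P (u + v) a₃)
    (h₁ : rwidth P u ≤ rwidth P v) (h₂ : rwidth P v ≤ rwidth P (u + v))
    (h₃ : rwidth P (u + v) ≤ rwidth P (v - u)) :
    3 / 8 * m ^ 2 ≤ volume.real P + 1 / 2 * (a₁ ^ 2 + a₂ ^ 2 + a₃ ^ 2) := by
  have dich : ∀ {a w : ℝ}, a = max (m - w) 0 → (a = 0 ∧ m ≤ w) ∨ (0 < a ∧ w = m - a) := by
    intro a w h
    rcases le_total (m - w) 0 with h' | h'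
    · left
      exact ⟨by rw [h, max_eq_right h'], by linarith⟩
    · rw [max_eq_left h'] at h
      rcases h'.eq_or_lt with h'' | h''
      · left; exact ⟨by linarith, by linarith⟩
      · right; exact ⟨by linarith, by linarith⟩
  have p₁ : 0 ≤ a₁ := ha₁ ▸ le_max_right _ _
  have p₂ : 0 ≤ a₂ := ha₂ ▸ le_max_right _ _
  have p₃ : 0 ≤ a₃ := ha₃ ▸ le_max_right _ _
  have c0 : cross u v ≠ 0 := fun h => by simp [h] at huv
  have hu : u ≠ 0 := fun h => c0 (by simp [h, cross])
  have hv : v ≠ 0 := fun h => c0 (by simp [h, cross])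
  have c1 : cross u (u + v) = cross u v := by simp [cross]; ring
  have c2 : cross v (u + v) = -cross u v := by simp [cross]; ring
  have c3 : cross u (v - u) = cross u v := by simp [cross]; ring
  have c4 : cross v (v - u) = cross u v := by simp [cross]; ring
  have c5 : cross (u + v) (v - u) = 2 * cross u v := by simp [cross]; ring
  have c6 : cross v u = -cross u v := by simp only [cross]; ring
  have c7 : ∀ w, cross w w = 0 := fun w => by simp [cross]; ring
  have c8 : cross (u + v) u = -cross u v := by simp [cross]; ring
  have c9 : cross (u + v) v = cross u v := by simp [cross]; ring
  have huv' : u + v ≠ 0 := fun h => c0 (by rw [← c1, h]; simp [cross])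
  -- cut along the three directions in turn
  obtain ⟨Q₁, hQ₁⟩ : ∃ Q, Q = slice P (a₁ • rot u) := ⟨_, rfl⟩
  have v₁ := volume_slice hP hc hne hu p₁ hS₁
  have w₁ := rwidth_slice hP hc hu p₁ hS₁ hne
  have s₂ := hasFaceSegments_slice hc hu p₁ hS₁ hS₂ c0
  have s₃ := hasFaceSegments_slice hc hu p₁ hS₁ hS₃ (by rwa [c1])
  have k₁ := isCompact_slice hP (a₁ • rot u)
  have x₁ := convex_slice hc (a₁ • rot u)
  have n₁ := slice_nonempty hc hu p₁ hS₁ hne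
  rw [← hQ₁] at v₁ w₁ s₂ s₃ k₁ x₁ n₁
  obtain ⟨Q₂, hQ₂⟩ : ∃ Q, Q = slice Q₁ (a₂ • rot v) := ⟨_, rfl⟩
  have v₂ := volume_slice k₁ x₁ n₁ hv p₂ s₂
  have w₂ := rwidth_slice k₁ x₁ hv p₂ s₂ n₁
  have s₃ := hasFaceSegments_slice x₁ hv p₂ s₂ s₃ (by rw [c2]; exact neg_ne_zero.2 c0)
  have k₂ := isCompact_slice k₁ (a₂ • rot v)
  have x₂ := convex_slice x₁ (a₂ • rot v)
  have n₂ := slice_nonempty x₁ hv p₂ s₂ n₁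
  rw [← hQ₂] at v₂ w₂ s₃ k₂ x₂ n₂
  obtain ⟨Q, hQ⟩ : ∃ Q, Q = slice Q₂ (a₃ • rot (u + v)) := ⟨_, rfl⟩
  have v₃ := volume_slice k₂ x₂ n₂ huv' p₃ s₃
  have w₃ := rwidth_slice k₂ x₂ huv' p₃ s₃ n₂
  have k := isCompact_slice k₂ (a₃ • rot (u + v))
  have x := convex_slice x₂ (a₃ • rot (u + v))
  have n := slice_nonempty x₂ huv' p₃ s₃ n₂
  rw [← hQ] at v₃ w₃ k x n
  have Wu : rwidth Q u = rwidth P u - a₂ - a₃ := by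
    rw [w₃, w₂, w₁, c8, c6, c7, abs_neg, huv, abs_zero]; ring
  have Wv : rwidth Q v = rwidth P v - a₁ - a₃ := by
    rw [w₃, w₂, w₁, c9, c7, huv, abs_zero]; ring
  have Ws : rwidth Q (u + v) = rwidth P (u + v) - a₁ - a₂ := by
    rw [w₃, w₂, w₁, c7, c2, c1, abs_neg, huv, abs_zero]; ring
  have Wd : rwidth Q (v - u) = rwidth P (v - u) - a₁ - a₂ - 2 * a₃ := by
    rw [w₃, w₂, w₁, c5, c4, c3, abs_mul, huv]; norm_num; ring
  have W₂ : rwidth Q₂ (u + v) = rwidth P (u + v) - a₁ - a₂ := by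
    rw [w₂, w₁, c2, c1, abs_neg, huv]; ring
  have W₁ : rwidth Q₁ v = rwidth P v - a₁ := by
    rw [w₁, huv]; ring
  rw [W₂] at v₃
  rw [W₁] at v₂
  have Wn := rwidth_nonneg k n u
  have d₁ := dich ha₁
  have d₂ := dich ha₂
  have d₃ := dich ha₃
  have reduced : rwidth Q u ≤ rwidth Q v ∧ rwidth Q v ≤ rwidth Q (u + v) ∧
      rwidth Q v ≤ rwidth Q (v - u) := by
    rcases d₃ with ⟨d₃, d₃'⟩ | ⟨d₃, d₃'⟩
    · rw [Wu, Wv, Ws, Wd]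
      rcases d₁ with ⟨d₁, d₁'⟩ | ⟨d₁, d₁'⟩ <;> rcases d₂ with ⟨d₂, d₂'⟩ | ⟨d₂, d₂'⟩ <;>
        exact ⟨by linarith, by linarith, by linarith⟩
    -- A positive `a₃` puts all three widths below `m`, up to zero defects being excluded by the
    -- ordering. Then Q has the same width m − s along `u`, `v` and `u + v`, and the width along `v
    -- − u` follows from `rwidth_le_rwidth_sub`.
    · have e₁ : rwidth P u = m - a₁ := by
        rcases d₁ with ⟨d₁, d₁'⟩ | ⟨d₁, d₁'⟩ <;> linarith
      have e₂ : rwidth P v = m - a₂ := by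
        rcases d₂ with ⟨d₂, d₂'⟩ | ⟨d₂, d₂'⟩ <;> linarith
      have := rwidth_le_rwidth_sub k n (u := u) (v := v) (by rw [Wu, Ws]; linarith)
      refine ⟨by linarith, by linarith, by linarith⟩
  have base := three_eighths_rwidth_sq_le k x n huv reduced.1 reduced.2.1 reduced.2.2
  have aw : ∀ {a w : ℝ}, (a = 0 ∧ m ≤ w) ∨ (0 < a ∧ w = m - a) → a * w = a * (m - a) := by
    rintro a w (⟨h, -⟩ | ⟨-, h⟩) <;> rw [h] <;> ring
  have m₁ := aw d₁
  have m₂ := aw d₂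
  have m₃ := aw d₃
  -- If `a₁` vanishes, so do the other defects; otherwise this number is the width of Q along `u`.
  have ht : 0 ≤ m - (a₁ + a₂ + a₃) := by
    rcases d₁ with ⟨d₁, d₁'⟩ | ⟨d₁, d₁'⟩
    · rcases d₂ with ⟨d₂, d₂'⟩ | ⟨d₂, d₂'⟩ <;> rcases d₃ with ⟨d₃, d₃'⟩ | ⟨d₃, d₃'⟩ <;> linarith
    · linarith
  have htW : m - (a₁ + a₂ + a₃) ≤ rwidth Q u := by
    rw [Wu]
    rcases d₁ with ⟨d₁, d₁'⟩ | ⟨d₁, d₁'⟩ <;> linarith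
  have sq := pow_le_pow_left₀ ht htW 2
  have hs : 0 ≤ (a₁ + a₂ + a₃) * (m - (a₁ + a₂ + a₃)) := mul_nonneg (by linarith) ht
  -- With s the sum of the defects and t = m − s, the bounds add up to (m² − t²)/2 + 3t²/8, and `hs`
  -- gives t² ≤ m².
  nlinarith [mul_nonneg p₁ p₂]

/-! ### Lattice vectors, and widths of hulls of lattice sets. -/

/-- The determinant of two lattice vectors. -/
def latticeCross (u v : ℤ × ℤ) : ℤ := u.1 * v.2 - u.2 * v.1

/-- The lattice vector `u` turned by a right angle. -/
def latticeRot (u : ℤ × ℤ) : ℤ × ℤ := (-u.2, u.1)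

theorem pair_toPlane (u v : ℤ × ℤ) : pair (toPlane u) (toPlane v) = (dot u v : ℝ) := by
  simp [pair, toPlane, dot]

theorem cross_toPlane (u v : ℤ × ℤ) :
    cross (toPlane u) (toPlane v) = (latticeCross u v : ℝ) := by
  simp [cross, toPlane, latticeCross]

theorem rot_toPlane (u : ℤ × ℤ) : rot (toPlane u) = toPlane (latticeRot u) := by
  simp [rot, toPlane, latticeRot]

theorem toPlane_add (u v : ℤ × ℤ) : toPlane (u + v) = toPlane u + toPlane v := by
  simp [toPlane]

theorem toPlane_sub (u v : ℤ × ℤ) : toPlane (u - v) = toPlane u - toPlane v := by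
  simp [toPlane]

theorem toPlane_smul (k : ℤ) (u : ℤ × ℤ) : toPlane (k • u) = (k : ℝ) • toPlane u := by
  simp [toPlane]

theorem toPlane_ne_zero {u : ℤ × ℤ} (hu : u ≠ 0) : toPlane u ≠ 0 := by
  intro h
  apply hu
  simpa [toPlane, Prod.ext_iff] using h

theorem dot_neg (u v : ℤ × ℤ) : dot (-u) v = -dot u v := by
  simp [dot]; ring

theorem dot_sub (u v w : ℤ × ℤ) : dot u (v - w) = dot u v - dot u w := by
  simp [dot]; ring

theorem exists_width_eq {B : Set (ℤ × ℤ)} (hB : B.Finite) (hne : B.Nonempty) (u : ℤ × ℤ) :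
    ∃ x ∈ B, ∃ y ∈ B, width u B = dot u x - dot u y ∧
      ∀ z ∈ B, dot u y ≤ dot u z ∧ dot u z ≤ dot u x := by
  obtain ⟨x, hx, hxm⟩ := Set.exists_max_image B (dot u) hB hne
  obtain ⟨y, hy, hym⟩ := Set.exists_min_image B (dot u) hB hne
  refine ⟨x, hx, y, hy, ?_, fun z hz => ⟨hym z hz, hxm z hz⟩⟩
  refine IsGreatest.csSup_eq ⟨⟨x, hx, y, hy, (dot_sub _ _ _).symm⟩, ?_⟩
  rintro _ ⟨z, hz, w, hw, rfl⟩
  rw [dot_sub]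
  linarith [hxm z hz, hym w hw]

section

variable {B : Set (ℤ × ℤ)}

theorem dot_sub_le_width (hB : B.Finite) (u : ℤ × ℤ) {x y : ℤ × ℤ} (hx : x ∈ B) (hy : y ∈ B) :
    dot u x - dot u y ≤ width u B := by
  obtain ⟨z, hz, w, hw, h, hm⟩ := exists_width_eq hB ⟨x, hx⟩ u
  rw [h]
  linarith [(hm x hx).2, (hm y hy).1]

theorem width_nonneg (hB : B.Finite) (hne : B.Nonempty) (u : ℤ × ℤ) : 0 ≤ width u B := by
  obtain ⟨x, hx⟩ := hne
  simpa using dot_sub_le_width hB u hx hx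

theorem isCompact_hull (hB : B.Finite) : IsCompact (hull B) :=
  (hB.image _).isCompact_convexHull ℝ

theorem toPlane_mem_hull {x : ℤ × ℤ} (hx : x ∈ B) : toPlane x ∈ hull B :=
  subset_convexHull ℝ _ ⟨x, hx, rfl⟩

theorem hull_nonempty (hne : B.Nonempty) : (hull B).Nonempty :=
  hne.imp' _ fun _ => toPlane_mem_hull

theorem supp_hull {u x : ℤ × ℤ} (hx : x ∈ B) (h : ∀ z ∈ B, dot u z ≤ dot u x) :
    supp (hull B) (toPlane u) = dot u x := by
  rw [← pair_toPlane]
  refine supp_eq (toPlane_mem_hull hx) fun y hy => ?_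
  have hc : Convex ℝ {y | pair (toPlane u) y ≤ pair (toPlane u) (toPlane x)} := by
    intro a ha b hb s t hs ht hst
    rw [Set.mem_ofPred_eq] at *
    rw [pair_convex_combo]
    calc _ ≤ s * pair (toPlane u) (toPlane x) + t * pair (toPlane u) (toPlane x) := by gcongr
      _ = _ := by rw [← add_mul, hst, one_mul]
  refine convexHull_min ?_ hc hy
  rintro _ ⟨z, hz, rfl⟩
  rw [Set.mem_ofPred_eq, pair_toPlane, pair_toPlane]
  exact_mod_cast h z hz

theorem rwidth_hull (hB : B.Finite) (hne : B.Nonempty) (u : ℤ × ℤ) :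
    rwidth (hull B) (toPlane u) = width u B := by
  obtain ⟨x, hx, y, hy, h, hm⟩ := exists_width_eq hB hne u
  have h1 := supp_hull hx fun z hz => (hm z hz).2
  have h2 := supp_hull (u := -u) hy fun z hz => by
    rw [dot_neg, dot_neg]; exact neg_le_neg (hm z hz).1
  have h3 : toPlane (-u) = -toPlane u := by simp [toPlane]
  rw [h3] at h2
  rw [rwidth, h1, h2, h, dot_neg]
  push_cast
  ring

theorem width_neg (hB : B.Finite) (hne : B.Nonempty) (u : ℤ × ℤ) :
    width (-u) B = width u B := by
  have h3 : toPlane (-u) = -toPlane u := by simp [toPlane]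
  have := rwidth_hull hB hne (-u)
  rw [h3, rwidth_neg, rwidth_hull hB hne] at this
  exact_mod_cast this.symm

theorem dim_hull_le_one_iff :
    dim (hull B) ≤ 1 ↔ ∀ x ∈ B, ∀ y ∈ B, ∀ z ∈ B, latticeCross (y - x) (z - x) = 0 := by
  have e : dim (hull B) = Module.finrank ℝ (vectorSpan ℝ (toPlane '' B)) := by
    unfold dim hull
    rw [← direction_affineSpan, affineSpan_convexHull, direction_affineSpan]
  rw [e, ← collinear_iff_finrank_le_one]
  constructor
  · intro h x hx y hy z hz
    obtain ⟨v, hv⟩ := (collinear_iff_of_mem (Set.mem_image_of_mem _ hx)).1 h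
    obtain ⟨r, hr⟩ := hv _ (Set.mem_image_of_mem _ hy)
    obtain ⟨s, hs⟩ := hv _ (Set.mem_image_of_mem _ hz)
    have : cross (toPlane (y - x)) (toPlane (z - x)) = 0 := by
      rw [toPlane_sub, toPlane_sub, hr, hs]
      simp [cross]; ring
    rw [cross_toPlane] at this
    exact_mod_cast this
  · intro h
    by_cases hs : B.Subsingleton
    · exact (hs.image toPlane).induction_on (collinear_empty ℝ _) fun _ => collinear_singleton ℝ _
    · obtain ⟨x, hx, y, hy, hxy⟩ := Set.not_subsingleton_iff.1 hs
      rw [collinear_iff_of_mem (Set.mem_image_of_mem _ hx)]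
      refine ⟨toPlane (y - x), ?_⟩
      rintro _ ⟨z, hz, rfl⟩
      have hd : y - x ≠ 0 := sub_ne_zero.2 hxy.symm
      have hu : (((y - x).2, -(y - x).1) : ℤ × ℤ) ≠ 0 := by
        intro h
        apply hd
        simp only [Prod.mk_eq_zero, neg_eq_zero] at h
        exact Prod.ext h.2 h.1
      obtain ⟨s, hs⟩ := eq_smul_rot (u := toPlane ((y - x).2, -(y - x).1)) (x := toPlane (z - x))
        (toPlane_ne_zero hu) (by
          rw [pair_toPlane]
          have := h x hx y hy z hz
          simp only [latticeCross] at this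
          simp only [dot]
          exact_mod_cast (by linarith))
      refine ⟨s, ?_⟩
      rw [rot_toPlane] at hs
      simp only [latticeRot, neg_neg] at hs
      rw [← hs, toPlane_sub]
      simp

end

/-! ### From sides of given integer length to face segments. -/

/-- Lattice vectors on a line orthogonal to a primitive vector. -/
theorem exists_eq_smul_latticeRot {u : ℤ × ℤ} (hu : Int.gcd u.1 u.2 = 1) :
    ∃ e : ℤ × ℤ, ∀ w, dot u w = 0 → w = dot e w • latticeRot u := by
  obtain ⟨a, b, h⟩ := Int.isCoprime_iff_gcd_eq_one.2 hu
  refine ⟨(-b, a), fun w hw => ?_⟩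
  simp only [dot] at hw ⊢
  ext
  · simp only [latticeRot, Prod.smul_fst, smul_eq_mul]
    linear_combination (-w.1) * h + a * hw
  · simp only [latticeRot, Prod.smul_snd, smul_eq_mul]
    linear_combination (-w.2) * h + b * hw

/-- `a + 1` lattice points on a line orthogonal to a primitive vector span at least `a` steps. -/
theorem exists_long_lattice_chord {u : ℤ × ℤ} (hu : Int.gcd u.1 u.2 = 1) {s : Set (ℤ × ℤ)}
    {a : ℤ} (ha : 0 ≤ a) (hs : a ≤ (s.ncard : ℤ) - 1)
    (hperp : ∀ x ∈ s, ∀ y ∈ s, dot u (x - y) = 0) :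
    ∃ x ∈ s, ∃ y ∈ s, ∃ k : ℤ, a ≤ k ∧ y - x = k • latticeRot u := by
  have hpos : 0 < s.ncard := by omega
  have hfin := Set.finite_of_ncard_pos hpos
  have hne := (Set.ncard_pos hfin).1 hpos
  obtain ⟨e, he⟩ := exists_eq_smul_latticeRot hu
  obtain ⟨y, hy, hym⟩ := Set.exists_max_image s (dot e) hfin hne
  obtain ⟨x, hx, hxm⟩ := Set.exists_min_image s (dot e) hfin hne
  refine ⟨x, hx, y, hy, dot e (y - x), ?_, he _ (hperp y hy x hx)⟩
  have hinj : Set.InjOn (dot e) s := by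
    intro z hz w hw h
    have := he _ (hperp z hz w hw)
    rw [dot_sub, show dot e z = dot e w from h, sub_self, zero_smul] at this
    exact sub_eq_zero.1 this
  have hsub : dot e '' s ⊆ Set.Icc (dot e x) (dot e y) := by
    rintro _ ⟨z, hz, rfl⟩
    exact ⟨hxm z hz, hym z hz⟩
  have hcard := Set.ncard_le_ncard hsub (Set.finite_Icc _ _)
  rw [hinj.ncard_image, ← Finset.coe_Icc, Set.ncard_coe_finset, Int.card_Icc] at hcard
  rw [dot_sub]
  have := hxm y hy
  omega

/-- The functional exposing `E` is constant along two lattice points of `E` that differ by a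
positive multiple of `rot u`, so it is a multiple of u · x. -/
theorem IsSide.exists_face {P E : Set (ℝ × ℝ)} (hP : Convex ℝ P) (hdim : dim P = 2)
    (hE : IsSide P E) {u : ℤ × ℤ} (hu : Int.gcd u.1 u.2 = 1) (hperp : IsPerp u E) {a : ℤ}
    (ha : 0 < a) (hl : a ≤ integerLength E) :
    ∃ s : ℝ, s ≠ 0 ∧
      E = {x ∈ P | ∀ y ∈ P, s * pair (toPlane u) y ≤ s * pair (toPlane u) x} ∧
      ∃ p ∈ E, p + (a : ℝ) • rot (toPlane u) ∈ E := by
  obtain ⟨x, hx, y, hy, k, hk, hxy⟩ := exists_long_lattice_chord hu (s := latticePoints E) ha.le hl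
    (by
      intro x hx y hy
      have := hperp _ hx _ hy
      simp only [toPlane] at this
      simp only [dot, Prod.fst_sub, Prod.snd_sub]
      exact_mod_cast this)
  have hyx : toPlane y = toPlane x + (k : ℝ) • rot (toPlane u) := by
    rw [rot_toPlane, ← toPlane_smul, ← hxy, ← toPlane_add]; simp
  have hk0 : (0 : ℝ) < k := by exact_mod_cast ha.trans_le hk
  have hak : (a : ℝ) ≤ k := by exact_mod_cast hk
  have ha0 : (0 : ℝ) ≤ a := by exact_mod_cast ha.le
  have hx' : toPlane x ∈ E := hx
  have hy' : toPlane y ∈ E := hy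
  have hmem : toPlane x + (a : ℝ) • rot (toPlane u) ∈ E := by
    have := hE.1.convex hP hx' hy' (sub_nonneg.2 ((div_le_one hk0).2 hak))
      (div_nonneg ha0 hk0.le) (by ring)
    convert this using 1
    rw [hyx]
    match_scalars <;> field_simp
    ring
  obtain ⟨l, hl⟩ := hE.1 ⟨_, hx'⟩
  have hlin : ∀ z : ℝ × ℝ, l z = pair (l (1, 0), l (0, 1)) z := by
    intro z
    have : z = z.1 • ((1, 0) : ℝ × ℝ) + z.2 • ((0, 1) : ℝ × ℝ) := by ext <;> simp
    conv_lhs => rw [this]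
    rw [map_add, map_smul, map_smul]
    simp [pair]; ring
  have hl0 : l (rot (toPlane u)) = 0 := by
    have h1 := hl ▸ hx'
    have h2 := hl ▸ hy'
    have h3 := le_antisymm (h2.2 _ h1.1) (h1.2 _ h2.1)
    rw [hyx, map_add, map_smul, smul_eq_mul] at h3
    have : (k : ℝ) * l (rot (toPlane u)) = 0 := by linarith
    exact (mul_eq_zero.1 this).resolve_left hk0.ne'
  obtain ⟨s, hs⟩ : ∃ s : ℝ, ∀ z, l z = s * pair (toPlane u) z := by
    have hru : rot (toPlane u) ≠ 0 := by
      rw [rot_toPlane]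
      apply toPlane_ne_zero
      intro h
      simp only [latticeRot, Prod.mk_eq_zero, neg_eq_zero] at h
      simp [h.1, h.2] at hu
    obtain ⟨t, ht⟩ := eq_smul_rot (u := rot (toPlane u)) (x := (l (1, 0), l (0, 1))) hru (by
      rw [hlin] at hl0
      simp only [pair] at hl0 ⊢
      linarith)
    refine ⟨-t, fun z => ?_⟩
    rw [hlin, ht]
    simp [pair, rot]; ring
  simp only [hs] at hl
  refine ⟨s, ?_, hl, _, hx', hmem⟩
  -- The zero functional would expose all of `P`, which has dimension 2.
  rintro rfl
  have : E = P := by rw [hl]; simp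
  have h1 := hE.2
  rw [this, hdim] at h1
  omega

/-- Each side maximises a non-zero multiple of u · x. Multiples of equal sign expose the same face,
so distinct sides lie on opposite faces. -/
theorem hasFaceSegments_of_sides {P E F : Set (ℝ × ℝ)} (hP : Convex ℝ P) (hdim : dim P = 2)
    {u : ℤ × ℤ} (hu : Int.gcd u.1 u.2 = 1) {a : ℤ} (ha : 0 < a) (hEF : E ≠ F)
    (hE : IsSide P E) (hEu : IsPerp u E) (hEa : a ≤ integerLength E)
    (hF : IsSide P F) (hFu : IsPerp u F) (hFa : a ≤ integerLength F) :
    HasFaceSegments P (toPlane u) a := by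
  obtain ⟨s, hs, hEs, p, hp, hp'⟩ := hE.exists_face hP hdim hu hEu ha hEa
  obtain ⟨t, ht, hFt, q, hq, hq'⟩ := hF.exists_face hP hdim hu hFu ha hFa
  have face_pos : ∀ {r : ℝ}, 0 < r →
      {x ∈ P | ∀ y ∈ P, r * pair (toPlane u) y ≤ r * pair (toPlane u) x} =
      {x ∈ P | ∀ y ∈ P, pair (toPlane u) y ≤ pair (toPlane u) x} := by
    intro r hr
    simp only [mul_le_mul_iff_right₀ hr]
  have face_neg : ∀ {r : ℝ}, r < 0 →
      {x ∈ P | ∀ y ∈ P, r * pair (toPlane u) y ≤ r * pair (toPlane u) x} =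
      {x ∈ P | ∀ y ∈ P, pair (toPlane u) x ≤ pair (toPlane u) y} := by
    intro r hr
    simp only [mul_le_mul_left_of_neg hr]
  have top : ∀ {r : ℝ} {x}, 0 < r →
      x ∈ {x ∈ P | ∀ y ∈ P, r * pair (toPlane u) y ≤ r * pair (toPlane u) x} →
      x + (a : ℝ) • rot (toPlane u) ∈
        {x ∈ P | ∀ y ∈ P, r * pair (toPlane u) y ≤ r * pair (toPlane u) x} →
      HasFaceSegment P (toPlane u) a := by
    intro r x hr h h'
    rw [face_pos hr] at h h'
    exact ⟨x, h.1, h'.1, h.2⟩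
  have bot : ∀ {r : ℝ} {x}, r < 0 →
      x ∈ {x ∈ P | ∀ y ∈ P, r * pair (toPlane u) y ≤ r * pair (toPlane u) x} →
      x + (a : ℝ) • rot (toPlane u) ∈
        {x ∈ P | ∀ y ∈ P, r * pair (toPlane u) y ≤ r * pair (toPlane u) x} →
      HasFaceSegment P (-toPlane u) a := by
    intro r x hr h h'
    rw [face_neg hr] at h h'
    refine ⟨_, h'.1, ?_, fun y hy => ?_⟩
    · rw [rot_neg]; simpa using h.1
    · rw [pair_neg, pair_neg]
      exact neg_le_neg (h'.2 y hy)
  rw [hEs] at hp hp'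
  rw [hFt] at hq hq'
  rcases hs.lt_or_gt with hs | hs <;> rcases ht.lt_or_gt with ht | ht
  · exact absurd (by rw [hEs, hFt, face_neg hs, face_neg ht]) hEF
  · exact ⟨top ht hq hq', bot hs hp hp'⟩
  · exact ⟨top hs hp hp', bot ht hq hq'⟩
  · exact absurd (by rw [hEs, hFt, face_pos hs, face_pos ht]) hEF

theorem gcd_eq_one_of_latticeCross {u v : ℤ × ℤ} (h : |latticeCross u v| = 1) :
    Int.gcd u.1 u.2 = 1 ∧ Int.gcd v.1 v.2 = 1 := by
  rw [← Int.isCoprime_iff_gcd_eq_one, ← Int.isCoprime_iff_gcd_eq_one]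
  simp only [latticeCross] at h
  rcases (abs_eq zero_le_one).1 h with h | h
  · exact ⟨⟨v.2, -v.1, by linarith⟩, ⟨-u.2, u.1, by linarith⟩⟩
  · exact ⟨⟨-v.2, v.1, by linarith⟩, ⟨u.2, -u.1, by linarith⟩⟩

/-! ### Reduced bases and lattice directions. -/

/-- A unimodular basis that is reduced with respect to an even function. -/
theorem exists_reduced_basis (f : ℤ × ℤ → ℤ) (hf : ∀ u, 0 ≤ f u) (hneg : ∀ u, f (-u) = f u) :
    ∃ u v : ℤ × ℤ, |latticeCross u v| = 1 ∧ f u ≤ f v ∧ f v ≤ f (u + v) ∧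
      f (u + v) ≤ f (v - u) := by
  have hmin : ∀ S : Set (ℤ × ℤ), S.Nonempty → ∃ u ∈ S, ∀ w ∈ S, f u ≤ f w := by
    intro S hS
    obtain ⟨u, hu, h⟩ := (measure fun u => (f u).toNat).wf.has_min S hS
    refine ⟨u, hu, fun w hw => ?_⟩
    have := h w hw
    simp only [WellFoundedRelation.rel, InvImage, not_lt] at this
    have := hf u
    have := hf w
    omega
  obtain ⟨u, hu, hum⟩ := hmin {u | Int.gcd u.1 u.2 = 1} ⟨(1, 0), by simp⟩
  obtain ⟨a, b, hab⟩ := Int.isCoprime_iff_gcd_eq_one.2 hu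
  obtain ⟨v, hv, hvm⟩ := hmin {v | |latticeCross u v| = 1} ⟨(-b, a), by
    have : latticeCross u (-b, a) = 1 := by simp only [latticeCross]; linarith
    simp [this]⟩
  rw [Set.mem_ofPred_eq] at hv
  have h1 : f u ≤ f v := hum v (gcd_eq_one_of_latticeCross hv).2
  have h2 : f v ≤ f (u + v) := hvm _ (by
    have : latticeCross u (u + v) = latticeCross u v := by simp [latticeCross]; ring
    rw [Set.mem_ofPred_eq, this, hv])
  have h3 : f v ≤ f (v - u) := hvm _ (by
    have : latticeCross u (v - u) = latticeCross u v := by simp [latticeCross]; ring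
    rw [Set.mem_ofPred_eq, this, hv])
  -- Replacing `u` by `-u` exchanges the values at u + v and v − u, which settles the last
  -- inequality.
  rcases le_total (f (u + v)) (f (v - u)) with h | h
  · exact ⟨u, v, hv, h1, h2, h⟩
  · refine ⟨-u, v, ?_, by rwa [hneg], by rwa [neg_add_eq_sub], ?_⟩
    · have : latticeCross (-u) v = -latticeCross u v := by simp [latticeCross]; ring
      rw [this, abs_neg, hv]
    · rwa [neg_add_eq_sub, sub_neg_eq_add, add_comm v u]

theorem exists_mem_directions {u : ℤ × ℤ} (hu : Int.gcd u.1 u.2 = 1) :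
    ∃ v ∈ directions, v = u ∨ v = -u := by
  have hne : ¬ (u.1 = 0 ∧ u.2 = 0) := fun h => by simp [h.1, h.2] at hu
  by_cases h : 0 < u.1 ∨ (u.1 = 0 ∧ 0 < u.2)
  · exact ⟨u, ⟨hu, h⟩, Or.inl rfl⟩
  · refine ⟨-u, ⟨by simpa using hu, ?_⟩, Or.inr rfl⟩
    simp only [Prod.fst_neg, Prod.snd_neg]
    omega

/-- Finiteness of the support is essential: otherwise the `finsum` takes its default value 0. -/
theorem sum_le_finsum_mem {α : Type*} {D : Set α} {g : α → ℝ} (hg : ∀ x, 0 ≤ g x)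
    (hfin : {x ∈ D | g x ≠ 0}.Finite) {T : Finset α} (hT : ↑T ⊆ D) :
    ∑ x ∈ T, g x ≤ ∑ᶠ x ∈ D, g x := by
  classical
  rw [finsum_mem_eq_sum_of_subset (t := hfin.toFinset ∪ T) g]
  · exact Finset.sum_le_sum_of_subset_of_nonneg Finset.subset_union_right fun x _ _ => hg x
  · intro x hx
    simp only [Finset.coe_union, Set.Finite.coe_toFinset]
    exact Or.inl ⟨hx.1, hx.2⟩
  · intro x hx
    simp only [Finset.coe_union, Set.Finite.coe_toFinset] at hx
    exact hx.elim (fun h => h.1) fun h => hT h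

/-! ### The theorem for polygons and for segments. -/

section

variable {B : Set (ℤ × ℤ)} {m : ℕ}

theorem defect_nonneg (u : ℤ × ℤ) : 0 ≤ defect m u B := le_max_right _ _

theorem width_lt_of_defect_ne_zero {u : ℤ × ℤ} (h : defect m u B ≠ 0) : width u B < m := by
  by_contra! h'
  exact h (max_eq_right (by linarith))

theorem defect_neg (hB : B.Finite) (hne : B.Nonempty) (u : ℤ × ℤ) :
    defect m (-u) B = defect m u B := by
  rw [defect, width_neg hB hne, defect]

/-- The vector `u` is determined by its products with two independent differences of points, and the
width bounds both products. -/
theorem finite_width_lt (hB : B.Finite) {x y z : ℤ × ℤ} (hx : x ∈ B) (hy : y ∈ B) (hz : z ∈ B)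
    (h : latticeCross (y - x) (z - x) ≠ 0) (m : ℤ) : {u | width u B < m}.Finite := by
  refine Set.Finite.of_injOn (f := fun u => (dot u (y - x), dot u (z - x)))
    (t := Set.Icc (-m) m ×ˢ Set.Icc (-m) m) ?_ ?_
    ((Set.finite_Icc _ _).prod (Set.finite_Icc _ _))
  · intro u hu
    rw [Set.mem_ofPred_eq] at hu
    have h1 := dot_sub_le_width hB u hy hx
    have h2 := dot_sub_le_width hB u hx hy
    have h3 := dot_sub_le_width hB u hz hx
    have h4 := dot_sub_le_width hB u hx hz
    simp only [Set.mem_prod, Set.mem_Icc, dot_sub]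
    omega
  · intro u _ v _ huv
    simp only [Prod.mk.injEq, dot] at huv
    simp only [latticeCross] at h
    obtain ⟨h1, h2⟩ := huv
    refine Prod.ext ?_ ?_
    · apply mul_right_cancel₀ h
      linear_combination (z - x).2 * h1 - (y - x).2 * h2
    · apply mul_right_cancel₀ h
      linear_combination (y - x).1 * h2 - (z - x).1 * h1

theorem area_add_defects_ge_of_dim_two (hB : B.Finite) (hne : B.Nonempty)
    (hdim : dim (hull B) = 2)
    (hthick : ∀ u : ℤ × ℤ, u ≠ 0 → ∀ a : ℤ, 0 < a → width u B = m - a →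
      ∃ E F : Set (ℝ × ℝ), E ≠ F ∧ IsSide (hull B) E ∧ IsPerp u E ∧ a ≤ integerLength E ∧
        IsSide (hull B) F ∧ IsPerp u F ∧ a ≤ integerLength F) :
    {u ∈ directions | defect m u B ≠ 0}.Finite ∧
      3 / 8 * (m : ℝ) ^ 2 ≤ area B + 1 / 2 * ∑ᶠ u ∈ directions, (defect m u B : ℝ) ^ 2 := by
  have hfin : {u ∈ directions | defect m u B ≠ 0}.Finite := by
    have : ¬ dim (hull B) ≤ 1 := by omega
    rw [dim_hull_le_one_iff] at this
    push Not at this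
    obtain ⟨x, hx, y, hy, z, hz, h⟩ := this
    exact (finite_width_lt hB hx hy hz h m).subset fun u hu => width_lt_of_defect_ne_zero hu.2
  refine ⟨hfin, ?_⟩
  have hP := isCompact_hull hB
  have hc : Convex ℝ (hull B) := convex_convexHull ℝ _
  have hPne := hull_nonempty hne
  obtain ⟨u, v, huv, h1, h2, h3⟩ := exists_reduced_basis (fun u => width u B)
    (width_nonneg hB hne) (width_neg hB hne)
  have gu := (gcd_eq_one_of_latticeCross huv).1
  have gv := (gcd_eq_one_of_latticeCross huv).2
  have guv : Int.gcd (u + v).1 (u + v).2 = 1 := by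
    refine (gcd_eq_one_of_latticeCross (u := u) ?_).2
    rw [← huv]
    congr 1
    simp [latticeCross]; ring
  have faces : ∀ w : ℤ × ℤ, Int.gcd w.1 w.2 = 1 →
      HasFaceSegments (hull B) (toPlane w) (defect m w B : ℝ) := by
    intro w hw
    rcases (defect_nonneg (m := m) (B := B) w).eq_or_lt with h | h
    · rw [← h, Int.cast_zero]
      exact hasFaceSegments_zero hP hPne _
    · have hd : width w B = m - defect m w B := by
        unfold defect at h ⊢
        omega
      obtain ⟨E, F, hEF, hE, hEu, hEa, hF, hFu, hFa⟩ :=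
        hthick w (by rintro rfl; simp at hw) _ h hd
      exact hasFaceSegments_of_sides hc hdim hw h hEF hE hEu hEa hF hFu hFa
  have hdef : ∀ w, (defect m w B : ℝ) = max (m - rwidth (hull B) (toPlane w)) 0 := by
    intro w
    rw [rwidth_hull hB hne, defect]
    push_cast
    rfl
  have key := area_add_defects_ge hP hc hPne (u := toPlane u) (v := toPlane v) (m := m)
    (a₃ := (defect m (u + v) B : ℝ))
    (by rw [cross_toPlane]; exact_mod_cast huv) (Nat.cast_nonneg m) (hdef u) (hdef v)
    (by rw [← toPlane_add]; exact hdef (u + v)) (faces u gu) (faces v gv)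
    (by rw [← toPlane_add]; exact faces _ guv)
    (by rw [rwidth_hull hB hne, rwidth_hull hB hne]; exact_mod_cast h1)
    (by rw [← toPlane_add, rwidth_hull hB hne, rwidth_hull hB hne]; exact_mod_cast h2)
    (by
      rw [← toPlane_add, ← toPlane_sub, rwidth_hull hB hne, rwidth_hull hB hne]
      exact_mod_cast h3)
  obtain ⟨u', hu', eu⟩ := exists_mem_directions gu
  obtain ⟨v', hv', ev⟩ := exists_mem_directions gv
  obtain ⟨w', hw', ew⟩ := exists_mem_directions guv
  have hdefect : ∀ {x y : ℤ × ℤ}, x = y ∨ x = -y → defect m x B = defect m y B := by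
    rintro x y (rfl | rfl)
    · rfl
    · exact defect_neg hB hne y
  -- Determinant ±1 excludes equality up to sign, so the three basis directions contribute three
  -- different terms to the sum.
  have hne' : ∀ {x y x' y' : ℤ × ℤ}, |latticeCross x y| = 1 → (x' = x ∨ x' = -x) →
      (y' = y ∨ y' = -y) → x' ≠ y' := by
    rintro x y x' _ hxy hx hy rfl
    have h0 : latticeCross x y = 0 := by
      rcases hx with hx | hx <;> rcases hy with hy | hy <;> rw [hx] at hy
      · rw [hy]; simp only [latticeCross]; ring
      · rw [hy]; simp only [latticeCross, Prod.fst_neg, Prod.snd_neg]; ring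
      · rw [← hy]; simp only [latticeCross, Prod.fst_neg, Prod.snd_neg]; ring
      · rw [neg_inj.1 hy]; simp only [latticeCross]; ring
    simp [h0] at hxy
  have n1 : u' ≠ v' := hne' huv eu ev
  have n2 : u' ≠ w' := hne' (y := u + v) (by
    rw [← huv]; congr 1; simp [latticeCross]; ring) eu ew
  have n3 : v' ≠ w' := hne' (y := u + v) (by
    rw [← huv, ← abs_neg]; congr 1; simp [latticeCross]; ring) ev ew
  have hsum := sum_le_finsum_mem (D := directions) (g := fun w => (defect m w B : ℝ) ^ 2)
    (fun _ => sq_nonneg _) (by simpa using hfin) (T := {u', v', w'}) (by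
      intro z hz
      simp only [Finset.coe_insert, Finset.coe_singleton, Set.mem_insert_iff,
        Set.mem_singleton_iff] at hz
      rcases hz with rfl | rfl | rfl <;> assumption)
  rw [Finset.sum_insert (by simp [n1, n2]), Finset.sum_insert (by simp [n3]),
    Finset.sum_singleton, hdefect eu, hdefect ev, hdefect ew] at hsum
  have harea : area B = volume.real (hull B) := rfl
  rw [harea]
  linarith

theorem area_nonneg : 0 ≤ area B := ENNReal.toReal_nonneg

theorem area_add_defects_ge_of_dim_one (hB : B.Finite) (hne : B.Nonempty)
    (hZ : IsZConvex B) (hdim : dim (hull B) = 1) (hlen : (m : ℤ) ≤ integerLength (hull B)) :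
    {u ∈ directions | defect m u B ≠ 0}.Finite ∧
      3 / 8 * (m : ℝ) ^ 2 ≤ area B + 1 / 2 * ∑ᶠ u ∈ directions, (defect m u B : ℝ) ^ 2 := by
  have hcard : (m : ℤ) ≤ (B.ncard : ℤ) - 1 := by
    have h : latticePoints (hull B) = B := hZ.symm
    rwa [integerLength, h] at hlen
  have hcol := dim_hull_le_one_iff.1 hdim.le
  have hsumnn : 0 ≤ ∑ᶠ u ∈ directions, (defect m u B : ℝ) ^ 2 :=
    finsum_nonneg fun _ => finsum_nonneg fun _ => sq_nonneg _
  -- For m = 0 no width is below `m`; for m > 0 the length bound provides two points that fix the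
  -- direction of the segment.
  rcases Nat.eq_zero_or_pos m with rfl | hm
  · refine ⟨?_, by simpa using add_nonneg area_nonneg (mul_nonneg (by norm_num) hsumnn)⟩
    convert Set.finite_empty
    refine Set.eq_empty_of_forall_notMem fun u hu => ?_
    have := width_lt_of_defect_ne_zero hu.2
    have := width_nonneg hB hne u
    simp at *
    omega
  obtain ⟨x, hx, y, hy, hxy⟩ := (Set.one_lt_ncard hB).1 (by omega : 1 < B.ncard)
  obtain ⟨n, hn, hd⟩ : ∃ n : ℤ × ℤ, Int.gcd n.1 n.2 = 1 ∧ dot n (y - x) = 0 ∧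
      ∃ g : ℤ, g ≠ 0 ∧ y - x = g • latticeRot n := by
    have hg : Int.gcd (y - x).1 (y - x).2 ≠ 0 := by
      rw [Ne, Int.gcd_eq_zero_iff]
      rintro ⟨h1, h2⟩
      exact hxy (sub_eq_zero.1 (Prod.ext h1 h2)).symm
    obtain ⟨p, q, hpq, h1, h2⟩ := Int.exists_gcd_one (Nat.pos_of_ne_zero hg)
    refine ⟨(q, -p), by simpa [Int.gcd_comm] using hpq, ?_, (Int.gcd (y - x).1 (y - x).2 : ℤ),
      by exact_mod_cast hg, ?_⟩
    · simp only [dot]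
      linear_combination q * h1 - p * h2
    · ext
      · simp only [latticeRot, neg_neg, Prod.smul_fst, smul_eq_mul]; rw [mul_comm, ← h1]
      · simp only [latticeRot, Prod.smul_snd, smul_eq_mul]; rw [mul_comm, ← h2]
  obtain ⟨hd, g, hg, hgd⟩ := hd
  have hperp : ∀ z ∈ B, ∀ w ∈ B, dot n (z - w) = 0 := by
    have : ∀ z ∈ B, dot n (z - x) = 0 := by
      intro z hz
      have := hcol x hx y hy z hz
      rw [hgd] at this
      simp only [latticeCross, latticeRot, Prod.smul_fst, Prod.smul_snd, smul_eq_mul] at this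
      have h : g * dot n (z - x) = 0 := by simp only [dot]; linarith
      exact (mul_eq_zero.1 h).resolve_left hg
    intro z hz w hw
    have h1 := this z hz
    have h2 := this w hw
    rw [dot_sub] at *
    omega
  obtain ⟨u, hu, eu⟩ := exists_mem_directions hn
  obtain ⟨p, hp, q, hq, k, hk, hpq⟩ := exists_long_lattice_chord hn (by omega) hcard hperp
  -- Two points of `B` differ by at least `m` primitive steps, so any `w` not parallel to the normal
  -- `n` has width at least `m`.
  have hpar : ∀ w, defect m w B ≠ 0 → latticeCross w n = 0 := by
    intro w hw
    by_contra hne0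
    have h1 := width_lt_of_defect_ne_zero hw
    have h2 := dot_sub_le_width hB w hq hp
    have h3 := dot_sub_le_width hB w hp hq
    have h4 : dot w q - dot w p = -(k * latticeCross w n) := by
      rw [← dot_sub, hpq]
      simp only [dot, latticeRot, latticeCross, Prod.smul_fst, Prod.smul_snd, smul_eq_mul]
      ring
    have h5 : |k * latticeCross w n| ≤ width w B := abs_le.2 ⟨by linarith, by linarith⟩
    rw [abs_mul, abs_of_nonneg (by omega : 0 ≤ k)] at h5
    have h6 := Int.one_le_abs hne0
    nlinarith
  have huniq : ∀ w ∈ directions, latticeCross w n = 0 → w = u := by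
    intro w hw hwn
    have hwu : latticeCross w u = 0 := by
      rcases eu with rfl | rfl
      · exact hwn
      · simp only [latticeCross, Prod.fst_neg, Prod.snd_neg] at hwn ⊢; linarith
    obtain ⟨e, he⟩ := exists_eq_smul_latticeRot hw.1
    have h1 := he (latticeRot u) (by
      simp only [dot, latticeRot]; simp only [latticeCross] at hwu; linarith)
    set c := dot e (latticeRot u)
    have h2 : u.2 = c * w.2 := by
      have := congrArg Prod.fst h1
      simp only [latticeRot, Prod.smul_fst, smul_eq_mul] at this
      linarith
    have h3 : u.1 = c * w.1 := by
      have := congrArg Prod.snd h1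
      simpa only [latticeRot, Prod.smul_snd, smul_eq_mul] using this
    have hc : IsUnit c := by
      have := Int.isCoprime_iff_gcd_eq_one.2 hu.1
      rw [h2, h3] at this
      exact this.isUnit_of_dvd' (dvd_mul_right _ _) (dvd_mul_right _ _)
    have hu2 := hu.2
    have hw2 := hw.2
    rcases Int.isUnit_iff.1 hc with hc | hc <;> rw [hc] at h2 h3
    · exact Prod.ext (by omega) (by omega)
    · omega
  have hfin : {u ∈ directions | defect m u B ≠ 0}.Finite :=
    (Set.finite_singleton u).subset fun w hw => huniq w hw.1 (hpar w hw.2)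
  refine ⟨hfin, ?_⟩
  have hwid : width n B = 0 := by
    obtain ⟨a, ha, b, hb, h, -⟩ := exists_width_eq hB hne n
    rw [h, ← dot_sub, hperp a ha b hb]
  have hdef : defect m u B = m := by
    have : defect m u B = defect m n B := by
      rcases eu with rfl | rfl
      · rfl
      · exact defect_neg hB hne n
    rw [this, defect, hwid]
    simp
  have hsum := sum_le_finsum_mem (D := directions) (g := fun w => (defect m w B : ℝ) ^ 2)
    (fun _ => sq_nonneg _) (by simpa using hfin) (T := {u}) (by simpa using hu)
  rw [Finset.sum_singleton, hdef, Int.cast_natCast] at hsum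
  have := area_nonneg (B := B)
  nlinarith [sq_nonneg (m : ℝ)]

/-! ### The minimal lattice width. -/

theorem minWidth_le (hB : B.Finite) (hne : B.Nonempty) {u : ℤ × ℤ} (hu : u ≠ 0) :
    minWidth B ≤ width u B :=
  csInf_le ⟨0, by rintro _ ⟨v, -, rfl⟩; exact width_nonneg hB hne v⟩ ⟨u, hu, rfl⟩

theorem minWidth_nonneg (hB : B.Finite) (hne : B.Nonempty) : 0 ≤ minWidth B :=
  le_csInf ⟨_, (1, 0), by simp, rfl⟩ (by rintro _ ⟨v, -, rfl⟩; exact width_nonneg hB hne v)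

theorem minWidth_eq_zero (hB : B.Finite) (hne : B.Nonempty) (hdim : dim (hull B) ≤ 1) :
    minWidth B = 0 := by
  refine le_antisymm ?_ (minWidth_nonneg hB hne)
  obtain ⟨n, hn, hperp⟩ : ∃ n : ℤ × ℤ, n ≠ 0 ∧ ∀ z ∈ B, ∀ w ∈ B, dot n (z - w) = 0 := by
    by_cases hs : B.Subsingleton
    · refine ⟨(1, 0), by simp, fun z hz w hw => ?_⟩
      rw [hs hz hw]; simp [dot]
    · obtain ⟨x, hx, y, hy, hxy⟩ := Set.not_subsingleton_iff.1 hs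
      refine ⟨((y - x).2, -(y - x).1), fun h => ?_, fun z hz w hw => ?_⟩
      · simp only [Prod.mk_eq_zero, neg_eq_zero] at h
        exact hxy (sub_eq_zero.1 (Prod.ext h.2 h.1)).symm
      · have h1 := dim_hull_le_one_iff.1 hdim x hx y hy z hz
        have h2 := dim_hull_le_one_iff.1 hdim x hx y hy w hw
        simp only [latticeCross, dot, Prod.fst_sub, Prod.snd_sub] at *
        linarith
  obtain ⟨a, ha, b, hb, h, -⟩ := exists_width_eq hB hne n
  rw [← dot_sub, hperp a ha b hb] at h
  exact h ▸ minWidth_le hB hne hn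

/-- With m equal to the minimal width, the condition on sides is vacuous and all defects are zero.
In dimension at most 1 the minimal width itself is zero. -/
theorem area_ge_minWidth_sq (hB : B.Finite) (hne : B.Nonempty) :
    3 / 8 * (minWidth B : ℝ) ^ 2 ≤ area B := by
  by_cases hdim : dim (hull B) ≤ 1
  · rw [minWidth_eq_zero hB hne hdim]
    simpa using area_nonneg
  have hdim2 : dim (hull B) = 2 := by
    have : dim (hull B) ≤ Module.finrank ℝ (ℝ × ℝ) := Submodule.finrank_le _
    rw [Module.finrank_prod, Module.finrank_self] at this
    omega
  obtain ⟨k, hk⟩ := Int.eq_ofNat_of_zero_le (minWidth_nonneg hB hne)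
  have hle : ∀ u : ℤ × ℤ, u ≠ 0 → (k : ℤ) ≤ width u B := fun u hu => hk ▸ minWidth_le hB hne hu
  have key := (area_add_defects_ge_of_dim_two (m := k) hB hne hdim2 fun u hu a ha h => by
    have := hle u hu
    omega).2
  have hzero : ∑ᶠ u ∈ directions, (defect k u B : ℝ) ^ 2 = 0 := by
    refine finsum_mem_eq_zero_of_forall_eq_zero fun u hu => ?_
    have hu0 : u ≠ 0 := by
      rintro rfl
      simp [directions] at hu
    have : defect k u B = 0 := max_eq_right (by linarith [hle u hu0])
    rw [this]; simp
  rw [hzero] at key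
  rw [hk, Int.cast_natCast]
  linarith

end

end LatticePolygon

theorem mainTheorem4 :
    (∀ (m : ℕ) (B : Set (ℤ × ℤ)), B.Finite → B.Nonempty →
      LatticePolygon.IsZConvex B → LatticePolygon.IsThick m B →
        {u ∈ LatticePolygon.directions | LatticePolygon.defect m u B ≠ 0}.Finite ∧
        LatticePolygon.area B +
            1 / 2 * ∑ᶠ u ∈ LatticePolygon.directions, (LatticePolygon.defect m u B : ℝ) ^ 2
          ≥ 3 / 8 * (m : ℝ) ^ 2) ∧
    (∀ B : Set (ℤ × ℤ), B.Finite → B.Nonempty → LatticePolygon.IsZConvex B →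
      LatticePolygon.area B ≥ 3 / 8 * (LatticePolygon.minWidth B : ℝ) ^ 2) := by
  refine ⟨fun m B hB hne hZ hthick => ?_, fun B hB hne _ => ?_⟩
  · rcases hthick with h | ⟨hdim, hlen⟩ | ⟨hdim, h⟩
    · exact absurd h hne.ne_empty
    · exact LatticePolygon.area_add_defects_ge_of_dim_one hB hne hZ hdim hlen
    · rw [← (hZ : B = LatticePolygon.zHull B)] at h
      exact LatticePolygon.area_add_defects_ge_of_dim_two hB hne hdim h
  · exact LatticePolygon.area_ge_minWidth_sq hB hne
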